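/- Let $T$ be a complete first-order theory and let $\mathfrak C\models T$ be a monster model, i.e. a $\kappa$-saturated and strongly $\kappa$-homogeneous model for some strong limit cardinal $\kappa>|T|$. "Small" and "bounded" mean of cardinality $<\kappa$; all tuples and parameter sets are small. Let $T$ be distal: for every indiscernible sequence $I$ of tuples of $\mathfrak C$ indexed by a (small) dense linear order and any two distinct Dedekind cuts $\mathfrak c_1,\mathfrak c_2$ of $I$, if inserting $a$ into $\mathfrak c_1$ leaves the sequence indiscernible, and so does inserting $b$ into $\mathfrak c_2$, then inserting both leaves it indiscernible. (A cut is Dedekind if its left part is nonempty without a last element and its right part is nonempty without a first element.) A set $X/E$ is hyperdefinable over $A$ if the set $X\subseteq\mathfrak C^\lambda$ ($\lambda<\kappa$) and the equivalence relation $E$ on $X$ are type-definable over $A$; types over $A$ of tuples of elements of $X/E$ and of $\mathfrak C$ are their $\mathrm{Aut}(\mathfrak C/A)$-orbits. $X/E$ is stable if for every $A$-indiscernible sequence $(a_i,b_i)_{i<\omega}$ with $a_i\in X/E$ and $b_i$ tuples of $\mathfrak C$ one has $\mathrm{tp}(a_i,b_j/A)=\mathrm{tp}(a_j,b_i/A)$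 for all $i\ne j$; $E$ is bounded if $|X/E|<\kappa$. 1. For every small $A$ and every set $X/E$ hyperdefinable over $A$: $X/E$ is stable if and only if $E$ is bounded. 2. In particular, let $G$ be a group type-definable over a small set $A_0$. For every small $A\supseteq A_0$, there are a smallest $A$-type-definable subgroup $G^{\mathrm{st}}_A$ of $G$ with $G/G^{\mathrm{st}}_A$ stable and a smallest $A$-type-definable subgroup $G^{00}_A$ of bounded index, and $G^{\mathrm{st}}_A=G^{00}_A$. If $T$ is NIP (a standing assumption for distal theories), then these subgroups do not depend on $A$; hence $G^{\mathrm{st}}$, the smallest type-definable (over small parameters) subgroup of $G$ with stable quotient, and $G^{00}$, the smallest one of bounded index, exist, and $G^{\mathrm{st}}=G^{00}$. -/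

import Mathlib

open FirstOrder Cardinal

universe u v w

namespace HyperStable

section RealTuples

variable (L : FirstOrder.Language.{u, v}) {M : Type w} [L.Structure M]

/-- `S` is type-definable over `A`: it is an intersection of `A`-definable sets, that is, the set
of realizations of a set of formulas with parameters in `A`. -/
def TypeDefinable (A : Set M) {ι : Type w} (S : Set (ι → M)) : Prop :=
  ∃ 𝒟 : Set (Set (ι → M)), (∀ D ∈ 𝒟, A.Definable L D) ∧ S = ⋂₀ 𝒟

/-- The sequence `s` of `ι`-tuples, indexed by a linear order `I`, is (order) indiscernible
over the empty set. -/
def Indiscernible {I : Type*} [LinearOrder I] {ι : Type w} (s : I → ι → M) : Prop :=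
  ∀ (n : ℕ) (i j : Fin n → I), StrictMono i → StrictMono j →
    ∀ φ : L.Formula (Fin n × ι),
      φ.Realize (fun p => s (i p.1) p.2) ↔ φ.Realize (fun p => s (j p.1) p.2)

/-- The concatenation `a + b` of two sequences. -/
def concat {I J Z : Type*} (a : I → Z) (b : J → Z) : I ⊕ₗ J → Z :=
  fun k => Sum.elim a b (ofLex k)

/-- The sequence with the single term `d`. -/
def single {Z : Type*} (d : Z) : Unit → Z := fun _ => d

/-- The part of the sequence `a` with indices in `C`. -/
def part {I Z : Type*} (a : I → Z) (C : Set I) : C → Z := fun i => a i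

/-- A Dedekind cut of a linear order `I`, given by its left part `C`: the cofinality of `C` and
the coinitiality of its complement are infinite, that is, `C` is nonempty without a last element
and `Cᶜ` is nonempty without a first element. -/
structure IsDedekindCut {I : Type*} [LinearOrder I] (C : Set I) : Prop where
  lower : IsLowerSet C
  left_nonempty : C.Nonempty
  left_noMax : ∀ x ∈ C, ∃ y ∈ C, x < y
  right_nonempty : Cᶜ.Nonempty
  right_noMin : ∀ x ∈ Cᶜ, ∃ y ∈ Cᶜ, y < x

/-- `d` fills the cut `(C, Cᶜ)` of the sequence `a`: the sequence `a|C + d + a|Cᶜ` is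
indiscernible. -/
def Fills {I : Type*} [LinearOrder I] {ι : Type w} (a : I → ι → M) (C : Set I) (d : ι → M) :
    Prop :=
  Indiscernible L (concat (part a C) (concat (single d) (part a Cᶜ)))

/-- The sequence `a` is distal: if `d₁` and `d₂` fill distinct Dedekind cuts of `a`, then `a` with
both of them inserted is indiscernible. (Two distinct cuts are comparable; `C₁` is the left one.) -/
def DistalSeq {I : Type*} [LinearOrder I] {ι : Type w} (a : I → ι → M) : Prop :=
  ∀ C₁ C₂ : Set I, IsDedekindCut C₁ → IsDedekindCut C₂ → C₁ ⊂ C₂ →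
    ∀ d₁ d₂ : ι → M, Fills L a C₁ d₁ → Fills L a C₂ d₂ →
      Indiscernible L
        (concat (part a C₁) (concat (single d₁) (concat (part a (C₂ \ C₁))
          (concat (single d₂) (part a C₂ᶜ)))))

variable (M)

/-- The complete theory of the monster model `M` (of degree `κ`) is distal: every dense
indiscernible sequence of tuples is distal. -/
def IsDistal (κ : Cardinal.{w}) : Prop :=
  ∀ (ι I : Type w) [LinearOrder I] [DenselyOrdered I], #ι < κ → #I < κ →
    ∀ a : I → ι → M, Indiscernible L a → DistalSeq L a

/-- The complete theory of the monster model `M` is NIP: there are no formula `φ(x, y)`,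
indiscernible sequence `(aᵢ)` and tuple `b` such that `φ(aᵢ, b)` holds exactly for even `i`. -/
def IsNIP : Prop :=
  ∀ (α β : Type w) (φ : L.Formula (α ⊕ β)),
    ¬ ∃ (a : ℕ → α → M) (b : β → M), Indiscernible L a ∧
      ∀ i, φ.Realize (Sum.elim (a i) b) ↔ Even i

variable {L}

/-- `M` is a monster model of `T` with degree of saturation `κ`, where `κ` is a strong limit
cardinal with `κ > |T| = |L| + ℵ₀`. -/
structure IsMonster (T : L.Theory) (κ : Cardinal.{w}) : Prop where
  model : M ⊨ T
  strongLimit : κ.IsStrongLimit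
  aleph0_lt : ℵ₀ < κ
  card_lt : Cardinal.lift.{w} L.card < Cardinal.lift.{max u v} κ
  /-- `κ`-saturation: every finitely satisfiable set of formulas over a small set, in a small
  tuple of variables, is realized. -/
  saturated : ∀ (α : Type w) (A : Set M), #α < κ → #A < κ →
    ∀ Γ : Set (L[[A]].Formula α),
      (∀ Γ₀ : Finset (L[[A]].Formula α), (Γ₀ : Set (L[[A]].Formula α)) ⊆ Γ →
        ∃ x : α → M, ∀ φ ∈ Γ₀, φ.Realize x) →
      ∃ x : α → M, ∀ φ ∈ Γ, φ.Realize x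
  /-- Strong `κ`-homogeneity: every elementary map `xᵢ ↦ yᵢ` between small sets extends to an
  automorphism. -/
  homogeneous : ∀ (α : Type w) (x y : α → M), #α < κ →
    (∀ φ : L.Formula α, φ.Realize x ↔ φ.Realize y) →
      ∃ σ : M ≃[L] M, ∀ i, σ (x i) = y i

end RealTuples

section Hyperdefinable

variable (L : FirstOrder.Language.{u, v}) {M : Type w} [L.Structure M]
variable {ι : Type w} {X : Set (ι → M)}

/-- The quotient of `X` by the equivalence relation `E` on `X` is hyperdefinable over `A`: both
`X` and `E` are type-definable over `A`. -/
structure IsHyperdefinable (A : Set M) (E : Setoid X) : Prop where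
  set : TypeDefinable L A X
  rel : TypeDefinable L A {z : ι ⊕ ι → M | ∃ x y : X, E x y ∧ z = Sum.elim x.1 y.1}

/-- `E` is bounded. -/
def IsBounded (κ : Cardinal.{w}) (E : Setoid X) : Prop := #(Quotient E) < κ

variable {L}

/-- The automorphism `σ` maps the pair `p`, consisting of an element of `X/E` and a tuple of
elements of `M`, to the pair `q`. (If `X` and `E` are invariant under `σ`, then `σ` acts on `X/E`,
and the first condition says that it maps `p.1` to `q.1`.) -/
def Maps (σ : M ≃[L] M) (E : Setoid X) {β : Type w} (p q : Quotient E × (β → M)) : Prop :=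
  (∃ x y : X, Quotient.mk E x = p.1 ∧ Quotient.mk E y = q.1 ∧ ∀ i, σ (x.1 i) = y.1 i) ∧
    ∀ k, σ (p.2 k) = q.2 k

variable (L)

/-- Two families of pairs as above have the same complete type over `A`: they are in the same
orbit of the group of automorphisms that fix `A` pointwise. -/
def SameType (A : Set M) (E : Setoid X) {β : Type w} {K : Type*}
    (p q : K → Quotient E × (β → M)) : Prop :=
  ∃ σ : M ≃[L] M, (∀ a ∈ A, σ a = a) ∧ ∀ k, Maps σ E (p k) (q k)

/-- The sequence of pairs `(aᵢ, bᵢ)`, with `aᵢ` in `X/E` and `bᵢ` a tuple of elements of `M`, is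
indiscernible over `A`. -/
def HyperIndiscernible (A : Set M) (E : Setoid X) {β : Type w}
    (s : ℕ → Quotient E × (β → M)) : Prop :=
  ∀ (n : ℕ) (i j : Fin n → ℕ), StrictMono i → StrictMono j →
    SameType L A E (fun k => s (i k)) (fun k => s (j k))

/-- The hyperdefinable (over `A`) set `X/E` is stable: for every sequence `(aᵢ, bᵢ)` that is
indiscernible over `A`, with `aᵢ` in `X/E` and `bᵢ` small tuples,
`tp(aᵢ, bⱼ / A) = tp(aⱼ, bᵢ / A)` for all `i ≠ j`. -/
def IsStable (κ : Cardinal.{w}) (A : Set M) (E : Setoid X) : Prop :=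
  ∀ β : Type w, #β < κ → ∀ (a : ℕ → Quotient E) (b : ℕ → β → M),
    HyperIndiscernible L A E (fun i => (a i, b i)) →
      ∀ i j : ℕ, i ≠ j →
        SameType L A E (fun _ : Unit => (a i, b j)) (fun _ : Unit => (a j, b i))

end Hyperdefinable

section Groups

variable (L : FirstOrder.Language.{u, v}) {M : Type w} [L.Structure M]
variable {ι : Type w} (G : Set (ι → M)) [Group G]

/-- `G` is a group type-definable over `A`: its underlying set and the graph of its multiplication
are type-definable over `A`. -/
structure IsTypeDefinableGroup (A : Set M) : Prop where
  set : TypeDefinable L A G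
  mul : TypeDefinable L A
    {z : ι ⊕ (ι ⊕ ι) → M | ∃ x y : G, z = Sum.elim x.1 (Sum.elim y.1 (x * y).1)}

variable {G}

/-- The subgroup `H` of `G` is type-definable over `A`. -/
def TypeDefinableSubgroup (A : Set M) (H : Subgroup G) : Prop :=
  TypeDefinable L A {x : ι → M | ∃ h : G, h ∈ H ∧ h.1 = x}

/-- `H` is the component `G⁰⁰` over `A`: the smallest subgroup of bounded index that is
type-definable over `A`. -/
def IsG00 (κ : Cardinal.{w}) (A : Set M) (H : Subgroup G) : Prop :=
  IsLeast {K : Subgroup G | TypeDefinableSubgroup L A K ∧ IsBounded κ (QuotientGroup.leftRel K)} H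

/-- `H` is the stable component `Gˢᵗ` over `A`: the smallest subgroup that is type-definable over
`A` and such that the hyperdefinable set `G/H` of left cosets is stable. -/
def IsGst (κ : Cardinal.{w}) (A : Set M) (H : Subgroup G) : Prop :=
  IsLeast {K : Subgroup G | TypeDefinableSubgroup L A K ∧
    IsStable L κ A (QuotientGroup.leftRel K)} H

end Groups

end HyperStable

/-!
Why the theorem is true. All arguments are phrased with `A`-definable sets of (infinite) tuples
instead of formulas: a set is type-definable if and only if it is the intersection of its definable
supersets (`typeDefinable_iff`), saturation is the finite intersection property for these
(`IsMonster.exists_mem`, `IsMonster.exists_comp_mem`), and homogeneity makes two tuples in the same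
`A`-definable sets conjugate over `A` (`IsMonster.exists_equiv`). Ramsey's theorem and saturation
give indiscernible sequences with a prescribed Ehrenfeucht–Mostowski type
(`IsMonster.exists_indiscernibleOver`).

*Bounded relations.* If `E` is bounded, then for each definable `D ⊇ E` finitely many fibres
`D(f, ·)` cover `X`; otherwise there would be indiscernible sequences of any small length with
terms that are pairwise unrelated by `D`, hence too many classes. Conversely, the fibres of these
finite covers that contain an element determine its class, which bounds the number of classes by a
cardinal that depends only on the number of `A`-definable sets (`IsMonster.mk_quotient_le`). In the
same way the classes in an indiscernible sequence are all equal if `E` is bounded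
(`IsMonster.rel_of_seq`), and then stability is immediate.

*Stable implies bounded.* If `E` is unbounded, take an indiscernible sequence of elements of `X`,
pairwise unrelated by some definable `D ⊇ E`, of order type `P + c₀ + R₀ + c₁ + R₁ + … + Q` with
`P`, `Rᵢ` and `Q` dense without endpoints. The pairs of the class of `cᵢ` and the tuple
`(P, Rᵢ, Q)` form an indiscernible sequence, so that stability yields an automorphism that maps
`(P, R₁, Q)` to `(P, R₀, Q)` and `c₀` to some `c` that is equivalent to `c₁`. Now `c` fills the
cut of `P + R₀ + Q` before `R₀`, and `c₁` fills the one after `R₀`. By distality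
`P + c + R₀ + c₁ + Q` is indiscernible, so that any two of its terms are related by `D`, like `c`
and `c₁`: a contradiction (`IsMonster.isBounded_of_isStable`).

*Groups.* Because the index of the bounded `A`-type-definable subgroups is uniformly bounded, their
intersection has bounded index (`IsMonster.exists_isG00`). By the first part it is also the smallest
type-definable subgroup with stable quotient. Under NIP, let `K` be a bounded subgroup that is
type-definable over `A`. If for some definable `D ⊇ K` no finitely many conjugates of `K` over `A₀`
have their intersection inside all conjugates of `D`, then there are an indiscernible sequence of
conjugates `Kⱼ` and elements `c'ₙ` such that `c'ₙ` is in `K₂ₘ` exactly for `m ≠ n`, and finite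
products of the `c'ₙ` produce a formula that alternates along an indiscernible sequence
(`IsMonster.exists_finset_conjugates`). Hence the intersection of all conjugates of `K` is already
the intersection of few of them. It has bounded index, and being invariant it is type-definable over
`A₀` (`IsMonster.typeDefinable_of_invariant`).
-/

namespace HyperStable

/-! ### Definable and type-definable sets in a monster model -/

section Small

variable {κ : Cardinal.{w}}

theorem mk_sum_lt (hκ : ℵ₀ ≤ κ) {α β : Type w} (hα : #α < κ) (hβ : #β < κ) : #(α ⊕ β) < κ := by
  rw [mk_sum, lift_id, lift_id]
  exact add_lt_of_lt hκ hα hβ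

theorem mk_prod_lt (hκ : ℵ₀ ≤ κ) {α β : Type w} (hα : #α < κ) (hβ : #β < κ) : #(α × β) < κ := by
  rw [mk_prod, lift_id, lift_id]
  exact mul_lt_of_lt hκ hα hβ

theorem mk_lt_of_countable (hκ : ℵ₀ < κ) {α : Type w} [Countable α] : #α < κ :=
  (mk_le_aleph0 (α := α)).trans_lt hκ

theorem mk_prod_countable_lt (hκ : ℵ₀ < κ) {J : Type} [Countable J] {α : Type w} (hα : #α < κ) :
    #(J × α) < κ := by
  rw [mk_prod, lift_uzero]
  exact mul_lt_of_lt hκ.le ((lift_le_aleph0.2 mk_le_aleph0).trans_lt hκ) (by simpa using hα)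

theorem power_lt_of_isStrongLimit (hκ : κ.IsStrongLimit) {a b : Cardinal.{w}} (ha : a < κ)
    (hb : b < κ) : a ^ b < κ :=
  calc a ^ b ≤ (2 ^ a) ^ b := power_le_power_right (cantor a).le
    _ = 2 ^ (a * b) := (power_mul).symm
    _ < κ := hκ.isStrongPrelimit (mul_lt_of_lt hκ.aleph0_le ha hb)

end Small

section Definable

variable {L : FirstOrder.Language.{u, v}} {M : Type w} [L.Structure M]

/-- The set defined by an `L`-formula with the parameters `p` is definable over every set that
contains the parameters. -/
theorem definable_of_formula {A : Set M} {γ α : Type*} (φ : L.Formula (γ ⊕ α)) (p : γ → M)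
    (hp : ∀ c, p c ∈ A) : A.Definable L {x : α → M | φ.Realize (Sum.elim p x)} := by
  rw [Set.definable_iff_exists_formula_sum]
  refine ⟨φ.relabel (Sum.map (fun c => (⟨p c, hp c⟩ : A)) id), ?_⟩
  ext x
  simp only [Set.mem_ofPred_eq, Language.Formula.realize_relabel]
  rw [show (Sum.elim (↑) x : A ⊕ α → M) ∘ Sum.map (fun c => (⟨p c, hp c⟩ : A)) id =
    Sum.elim p x by ext (_ | _) <;> rfl]

/-- Substituting fixed elements for some of the variables of a definable set. -/
theorem Definable.fix {A B : Set M} {α β γ : Type*} {D : Set (α → M)} (hD : A.Definable L D)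
    (hAB : A ⊆ B) (f : α → γ ⊕ β) (p : γ → M) (hp : ∀ c, p c ∈ B) :
    B.Definable L {x : β → M | (Sum.elim p x) ∘ f ∈ D} := by
  obtain ⟨φ, rfl⟩ := Set.definable_iff_exists_formula_sum.1 hD
  have := definable_of_formula (A := B)
    (φ.relabel (Sum.elim (fun a => Sum.inl (Sum.inl a)) (fun i => Sum.map Sum.inr id (f i))) :
      L.Formula ((A ⊕ γ) ⊕ β)) (Sum.elim (↑) p) (by rintro (a | c); exacts [hAB a.2, hp c])
  convert this using 1
  ext x
  simp only [Set.mem_ofPred_eq, Language.Formula.realize_relabel]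
  rw [iff_iff_eq]
  congr 1
  ext (a | i)
  · rfl
  · rcases h : f i with c | b <;> simp [h]

theorem Definable.map_mem {A : Set M} {α : Type*} {D : Set (α → M)} (hD : A.Definable L D)
    {σ : M ≃[L] M} (hσ : ∀ a ∈ A, σ a = a) {x : α → M} (hx : x ∈ D) : (fun i => σ (x i)) ∈ D := by
  obtain ⟨φ, rfl⟩ := Set.definable_iff_exists_formula_sum.1 hD
  have := (Language.StrongHomClass.realize_formula σ φ (v := Sum.elim (↑) x)).2
    (show φ.Realize (Sum.elim (↑) x) from hx)
  rw [show (σ ∘ Sum.elim ((↑) : A → M) x) = Sum.elim (↑) (fun i => σ (x i)) by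
    ext (a | i); exacts [hσ a a.2, rfl] ] at this
  exact this

theorem symm_fix {A : Set M} {σ : M ≃[L] M} (hσ : ∀ a ∈ A, σ a = a) : ∀ a ∈ A, σ.symm a = a := by
  intro a ha
  conv_lhs => rw [← hσ a ha]
  exact σ.symm_apply_apply a

/-- Parameters that are moved by an automorphism can be moved back, together with the variables. -/
theorem realize_elim_symm {A : Set M} {α : Type*} (σ : M ≃[L] M) (φ : L.Formula (A ⊕ α))
    (x : α → M) : φ.Realize (Sum.elim (fun a => σ.symm a) x) ↔
      φ.Realize (Sum.elim (↑) fun k => σ (x k)) := by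
  rw [← Language.StrongHomClass.realize_formula σ φ (v := Sum.elim _ x), iff_iff_eq]
  congr 1
  ext (a | k)
  exacts [σ.apply_symm_apply _, rfl]

theorem Definable.preimage_equiv {A B : Set M} {α : Type*} {D : Set (α → M)}
    (hD : A.Definable L D) (σ : M ≃[L] M) (hB : ∀ a ∈ A, σ.symm a ∈ B) :
    B.Definable L {x : α → M | (fun i => σ (x i)) ∈ D} := by
  obtain ⟨φ, rfl⟩ := Set.definable_iff_exists_formula_sum.1 hD
  convert definable_of_formula (A := B) φ (fun a => σ.symm a) (fun a => hB a a.2) using 1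
  ext x
  simp only [Set.mem_ofPred_eq]
  exact (realize_elim_symm σ φ x).symm

end Definable

section Monster

variable {L : FirstOrder.Language.{u, v}} {M : Type w} [L.Structure M] {T : L.Theory}
  {κ : Cardinal.{w}}

/-- Saturation, for definable sets: a family of sets definable over a small set, with the finite
intersection property, has a common point. -/
theorem IsMonster.exists_mem (hM : IsMonster M T κ) {α : Type w} {A : Set M} (hα : #α < κ)
    (hA : #A < κ) (𝒟 : Set (Set (α → M))) (h𝒟 : ∀ D ∈ 𝒟, A.Definable L D)
    (hfin : ∀ F : Finset (Set (α → M)), ↑F ⊆ 𝒟 → ∃ x, ∀ D ∈ F, x ∈ D) : ∃ x, ∀ D ∈ 𝒟, x ∈ D := by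
  classical
  obtain ⟨x, hx⟩ := hM.saturated α A hα hA {φ | Set.ofPred φ.Realize ∈ 𝒟} (by
    intro Γ hΓ
    obtain ⟨x, hx⟩ := hfin (Γ.image fun φ => Set.ofPred φ.Realize) (by
      intro D hD
      obtain ⟨φ, hφ, rfl⟩ := Finset.mem_image.1 (Finset.mem_coe.1 hD)
      exact hΓ hφ)
    exact ⟨x, fun φ hφ => hx _ (Finset.mem_image_of_mem _ hφ)⟩)
  refine ⟨x, fun D hD => ?_⟩
  obtain ⟨φ, rfl⟩ := h𝒟 D hD
  exact hx φ hD

/-- Homogeneity over a small set `A`: two small tuples in the same `A`-definable sets are conjugate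
over `A`. -/
theorem IsMonster.exists_equiv (hM : IsMonster M T κ) {α : Type w} {A : Set M} (hα : #α < κ)
    (hA : #A < κ) (x y : α → M) (h : ∀ D, A.Definable L D → x ∈ D → y ∈ D) :
    ∃ σ : M ≃[L] M, (∀ a ∈ A, σ a = a) ∧ ∀ i, σ (x i) = y i := by
  obtain ⟨σ, hσ⟩ := hM.homogeneous (A ⊕ α) (Sum.elim (↑) x) (Sum.elim (↑) y)
    (mk_sum_lt hM.aleph0_lt.le hA hα) (by
      intro φ
      have hd : A.Definable L {z : α → M | φ.Realize (Sum.elim (↑) z)} :=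
        Set.definable_iff_exists_formula_sum.2 ⟨φ, rfl⟩
      refine ⟨h _ hd, fun hy => ?_⟩
      by_contra hx
      exact h _ hd.compl hx hy)
  exact ⟨σ, fun a ha => hσ (Sum.inl ⟨a, ha⟩), fun i => hσ (Sum.inr i)⟩

end Monster

section TypeDefinable

variable {L : FirstOrder.Language.{u, v}} {M : Type w} [L.Structure M] {T : L.Theory}
  {κ : Cardinal.{w}} {α β : Type w} {A B : Set M} {S S' : Set (α → M)}

/-- A set is type-definable if and only if it is the intersection of all its definable
supersets. -/
theorem typeDefinable_iff :
    TypeDefinable L A S ↔ ∀ x, (∀ D, A.Definable L D → S ⊆ D → x ∈ D) → x ∈ S := by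
  constructor
  · rintro ⟨𝒟, h𝒟, rfl⟩ x hx D hD
    exact hx D (h𝒟 D hD) fun y hy => hy D hD
  · intro h
    refine ⟨{D | A.Definable L D ∧ S ⊆ D}, fun D hD => hD.1, ?_⟩
    ext x
    exact ⟨fun hx D hD => hD.2 hx, fun hx => h x fun D h1 h2 => hx D ⟨h1, h2⟩⟩

theorem TypeDefinable.of_definable (hS : A.Definable L S) : TypeDefinable L A S :=
  typeDefinable_iff.2 fun _ hx => hx S hS subset_rfl

theorem TypeDefinable.mono (hS : TypeDefinable L A S) (h : A ⊆ B) : TypeDefinable L B S :=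
  typeDefinable_iff.2 fun x hx => typeDefinable_iff.1 hS x fun D h1 h2 => hx D (h1.mono h) h2

theorem TypeDefinable.iInter {K : Sort*} {S : K → Set (α → M)} (h : ∀ k, TypeDefinable L A (S k)) :
    TypeDefinable L A (⋂ k, S k) :=
  typeDefinable_iff.2 fun x hx => Set.mem_iInter.2 fun k => typeDefinable_iff.1 (h k) x
    fun D h1 h2 => hx D h1 fun _ hy => h2 (Set.mem_iInter.1 hy k)

theorem TypeDefinable.inter (hS : TypeDefinable L A S) (hS' : TypeDefinable L A S') :
    TypeDefinable L A (S ∩ S') :=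
  typeDefinable_iff.2 fun x hx =>
    ⟨typeDefinable_iff.1 hS x fun D h1 h2 => hx D h1 fun _ hy => h2 hy.1,
     typeDefinable_iff.1 hS' x fun D h1 h2 => hx D h1 fun _ hy => h2 hy.2⟩

theorem TypeDefinable.preimage (hS : TypeDefinable L A S) (f : α → β) :
    TypeDefinable L A {z : β → M | z ∘ f ∈ S} :=
  typeDefinable_iff.2 fun x hx => typeDefinable_iff.1 hS (x ∘ f) fun D h1 h2 =>
    hx {z | z ∘ f ∈ D} (h1.preimage_comp f) fun _ hy => h2 hy

/-- Substituting fixed elements for some of the variables of a type-definable set. -/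
theorem TypeDefinable.fix (hS : TypeDefinable L A S) (hAB : A ⊆ B) {γ : Type*} (f : α → γ ⊕ β)
    (p : γ → M) (hp : ∀ c, p c ∈ B) : TypeDefinable L B {x : β → M | (Sum.elim p x) ∘ f ∈ S} :=
  typeDefinable_iff.2 fun _ hx => typeDefinable_iff.1 hS _ fun D h1 h2 =>
    hx {x | Sum.elim p x ∘ f ∈ D} (Definable.fix h1 hAB f p hp) fun _ hy => h2 hy

theorem TypeDefinable.map_mem (hS : TypeDefinable L A S) {σ : M ≃[L] M} (hσ : ∀ a ∈ A, σ a = a)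
    {x : α → M} (hx : x ∈ S) : (fun i => σ (x i)) ∈ S :=
  typeDefinable_iff.1 hS _ fun _ h1 h2 => Definable.map_mem h1 hσ (h2 hx)

theorem TypeDefinable.preimage_equiv (hS : TypeDefinable L A S) (σ : M ≃[L] M)
    (hB : ∀ a ∈ A, σ.symm a ∈ B) : TypeDefinable L B {x : α → M | (fun i => σ (x i)) ∈ S} :=
  typeDefinable_iff.2 fun _ hx => typeDefinable_iff.1 hS _ fun D h1 h2 =>
    hx {x | (fun i => σ (x i)) ∈ D} (Definable.preimage_equiv h1 σ hB) fun _ hy => h2 hy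

/-- Compactness, with the sets required of the subtuples `z ∘ f k` running through a family `𝒞` of
definable sets that is closed under finite intersections. -/
theorem IsMonster.exists_comp_mem_of_inter (hM : IsMonster M T κ) (hβ : #β < κ) (hA : #A < κ)
    {𝒞 : Set (Set (α → M))} (h𝒞 : ∀ C ∈ 𝒞, A.Definable L C) (huniv : Set.univ ∈ 𝒞)
    (hinter : ∀ C ∈ 𝒞, ∀ C' ∈ 𝒞, C ∩ C' ∈ 𝒞) {T' : Set (β → M)} (hT' : TypeDefinable L A T')
    {K : Sort*} (f : K → α → β) (h : ∀ C ∈ 𝒞, ∃ z ∈ T', ∀ k, z ∘ f k ∈ C) :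
    ∃ z ∈ T', ∀ k, ∀ C ∈ 𝒞, z ∘ f k ∈ C := by
  classical
  obtain ⟨z, hz⟩ := hM.exists_mem hβ hA
    ({C | A.Definable L C ∧ T' ⊆ C} ∪ {C | ∃ D ∈ 𝒞, ∃ k, C = {z | z ∘ f k ∈ D}}) (by
      rintro C (hC | ⟨D, hD, k, rfl⟩)
      · exact hC.1
      · exact (h𝒞 D hD).preimage_comp (f k)) (by
      intro F hF
      -- the finitely many members of `𝒞` that occur in `F` are replaced by their intersection
      have : ∀ F : Finset (Set (β → M)), (∀ C ∈ F, (A.Definable L C ∧ T' ⊆ C) ∨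
          ∃ D ∈ 𝒞, ∃ k, C = {z | z ∘ f k ∈ D}) →
          ∃ D ∈ 𝒞, ∀ z ∈ T', (∀ k, z ∘ f k ∈ D) → ∀ C ∈ F, z ∈ C := by
        intro F
        induction F using Finset.induction_on with
        | empty => exact fun _ => ⟨Set.univ, huniv, by simp⟩
        | insert C F _ ih =>
          intro hF
          obtain ⟨D, hD, hDF⟩ := ih fun C hC => hF C (Finset.mem_insert_of_mem hC)
          rcases hF C (Finset.mem_insert_self _ _) with hC | ⟨D', hD', k, rfl⟩
          · refine ⟨D, hD, fun z hz hzD C' hC' => ?_⟩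
            rcases Finset.mem_insert.1 hC' with rfl | hC'
            exacts [hC.2 hz, hDF z hz hzD C' hC']
          · refine ⟨D ∩ D', hinter D hD D' hD', fun z hz hzD C' hC' => ?_⟩
            rcases Finset.mem_insert.1 hC' with rfl | hC'
            exacts [(hzD k).2, hDF z hz (fun k => (hzD k).1) C' hC']
      obtain ⟨D, hD, hDF⟩ := this F fun C hC => hF hC
      obtain ⟨z, hz, hzD⟩ := h D hD
      exact ⟨z, hDF z hz hzD⟩)
  exact ⟨z, typeDefinable_iff.1 hT' z fun D h1 h2 => hz D (Or.inl ⟨h1, h2⟩), fun k D hD =>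
    hz {z | z ∘ f k ∈ D} (Or.inr ⟨D, hD, k, rfl⟩)⟩

/-- Compactness: to find a point of a type-definable set `T'` several of whose subtuples lie in a
type-definable set `S`, it suffices to find, for each definable superset `D` of `S`, such a point
for `D`. -/
theorem IsMonster.exists_comp_mem (hM : IsMonster M T κ) (hβ : #β < κ) (hB : #B < κ) (hAB : A ⊆ B)
    (hS : TypeDefinable L A S) {T' : Set (β → M)} (hT' : TypeDefinable L B T') {K : Sort*}
    (f : K → α → β) (h : ∀ D, A.Definable L D → S ⊆ D → ∃ z ∈ T', ∀ k, z ∘ f k ∈ D) :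
    ∃ z ∈ T', ∀ k, z ∘ f k ∈ S := by
  obtain ⟨z, hz, hzS⟩ := hM.exists_comp_mem_of_inter (𝒞 := {D | A.Definable L D ∧ S ⊆ D}) hβ hB
    (fun D hD => hD.1.mono hAB) ⟨Set.definable_univ, Set.subset_univ _⟩
    (fun D hD D' hD' => ⟨hD.1.inter hD'.1, Set.subset_inter hD.2 hD'.2⟩) hT' f
    (fun D hD => h D hD.1 hD.2)
  exact ⟨z, hz, fun k => typeDefinable_iff.1 hS _ fun D h1 h2 => hzS k D ⟨h1, h2⟩⟩

/-- If `x` lies in every `A`-definable set that contains the projection of the type-definable set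
`S`, then some conjugate of `x` over `A` lies in that projection. The parameters of `S` need not
be in `A`. -/
theorem IsMonster.exists_equiv_comp (hM : IsMonster M T κ) (hα : #α < κ) (hβ : #β < κ)
    (hA : #A < κ) (hB : #B < κ) (hAB : A ⊆ B) {S : Set (β → M)} (hS : TypeDefinable L B S)
    (f : α → β) (x : α → M) (hx : ∀ D, A.Definable L D → (∀ z ∈ S, z ∘ f ∈ D) → x ∈ D) :
    ∃ σ : M ≃[L] M, (∀ a ∈ A, σ a = a) ∧ ∃ z ∈ S, ∀ i, x i = σ (z (f i)) := by
  obtain ⟨z, hz, hzx⟩ := hM.exists_comp_mem_of_inter (𝒞 := {D | A.Definable L D ∧ x ∈ D})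
    (K := Unit) hβ hB (fun D hD => hD.1.mono hAB) ⟨Set.definable_univ, Set.mem_univ _⟩
    (fun D hD D' hD' => ⟨hD.1.inter hD'.1, hD.2, hD'.2⟩) hS (fun _ => f) (by
      intro D hD
      by_contra hcon
      push Not at hcon
      refine hx Dᶜ hD.1.compl (fun z hz hzD => ?_) hD.2
      obtain ⟨_, h⟩ := hcon z hz
      exact h hzD)
  obtain ⟨σ, hσ, hσx⟩ := hM.exists_equiv hα hA (z ∘ f) x (by
    intro D hD hzD
    by_contra hxD
    exact hzx () Dᶜ ⟨hD.compl, hxD⟩ hzD)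
  exact ⟨σ, hσ, z, hz, fun i => (hσx i).symm⟩

/-- Projections of type-definable sets are type-definable. -/
theorem IsMonster.typeDefinable_image_comp (hM : IsMonster M T κ) (hα : #α < κ) (hβ : #β < κ)
    (hA : #A < κ) {S : Set (β → M)} (hS : TypeDefinable L A S) (f : α → β) :
    TypeDefinable L A {x : α → M | ∃ z ∈ S, z ∘ f = x} := by
  refine typeDefinable_iff.2 fun x hx => ?_
  obtain ⟨σ, hσ, z, hz, hzx⟩ := hM.exists_equiv_comp hα hβ hA hA subset_rfl hS f x
    (fun D h1 h2 => hx D h1 (by rintro _ ⟨z, hz, rfl⟩; exact h2 z hz))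
  exact ⟨_, hS.map_mem hσ hz, funext fun i => (hzx i).symm⟩

/-- A set that is type-definable over some small set and invariant under the automorphisms over `A`
is type-definable over `A`. -/
theorem IsMonster.typeDefinable_of_invariant (hM : IsMonster M T κ) (hα : #α < κ) (hA : #A < κ)
    (hB : #B < κ) (hAB : A ⊆ B) (hS : TypeDefinable L B S)
    (hinv : ∀ σ : M ≃[L] M, (∀ a ∈ A, σ a = a) → ∀ x ∈ S, (fun i => σ (x i)) ∈ S) :
    TypeDefinable L A S := by
  refine typeDefinable_iff.2 fun x hx => ?_
  obtain ⟨σ, hσ, z, hz, hzx⟩ := hM.exists_equiv_comp hα hα hA hB hAB hS id x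
    (fun D h1 h2 => hx D h1 h2)
  rw [show x = fun i => σ (z i) from funext hzx]
  exact hinv σ hσ z hz

end TypeDefinable

/-! ### Indiscernible sequences -/

section Ramsey

/-- Ramsey's theorem for colourings of the increasing `n`-tuples of natural numbers with two
colours. -/
theorem exists_strictMono_homogeneous (n : ℕ) (c : (Fin n → ℕ) → Prop) :
    ∃ h : ℕ → ℕ, StrictMono h ∧
      ∀ i j : Fin n → ℕ, StrictMono i → StrictMono j → (c (h ∘ i) ↔ c (h ∘ j)) := by
  induction n with
  | zero =>
    exact ⟨id, strictMono_id, fun i j _ _ => by rw [Subsingleton.elim (id ∘ i) (id ∘ j)]⟩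
  | succ n ih =>
    -- colours of tuples with a varying last entry are decided by a nonprincipal ultrafilter
    let U := Filter.hyperfilter ℕ
    -- the new colour of `t` is the colour of almost all of its extensions by a last entry
    let c' : (Fin n → ℕ) → Prop := fun t => ∀ᶠ m in (U : Filter ℕ), c (Fin.snoc t m)
    have hr : ∀ x : ℕ, ∀ᶠ y in (U : Filter ℕ),
        x < y ∧ ∀ t : Fin n → ℕ, (∀ k, t k ≤ x) → (c (Fin.snoc t y) ↔ c' t) := by
      intro x
      refine Filter.Eventually.and ?_ ?_
      · refine Filter.mem_hyperfilter_of_finite_compl ((Set.finite_Iic x).subset ?_)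
        intro y hy
        simpa using hy
      · have hfin : {t : Fin n → ℕ | ∀ k, t k ≤ x}.Finite := Set.finite_Iic (fun _ : Fin n => x)
        refine (hfin.eventually_all (l := (U : Filter ℕ))
          (p := fun t y => c (Fin.snoc t y) ↔ c' t)).2 fun t _ => ?_
        by_cases ht : c' t
        · exact Filter.Eventually.mono ht fun y hy => iff_of_true hy ht
        · exact (Ultrafilter.eventually_not.2 ht).mono fun y hy => iff_of_false hy ht
    obtain ⟨f, -, hf⟩ := exists_seq_of_forall_finset_exists (fun _ : ℕ => True)
      (fun x y => x < y ∧ ∀ t : Fin n → ℕ, (∀ k, t k ≤ x) → (c (Fin.snoc t y) ↔ c' t))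
      (fun s _ => by
        obtain ⟨y, hy⟩ := (s.eventually_all.2 fun x _ => hr x).exists
        exact ⟨y, trivial, hy⟩)
    have hmono : StrictMono f := fun a b hab => (hf a b hab).1
    -- along `m ↦ f (m + 1)` the colour depends only on the first `n` entries; the shift provides a
    -- bound on these entries even if there are none
    have key : ∀ i : Fin (n + 1) → ℕ, StrictMono i →
        (c (fun k => f (i k + 1)) ↔ c' fun k : Fin n => f (i k.castSucc + 1)) := by
      intro i hi
      have := (hf (i (Fin.last n)) (i (Fin.last n) + 1) (Nat.lt_succ_self _)).2
        (fun k : Fin n => f (i k.castSucc + 1))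
        (fun k => hmono.monotone (hi (Fin.castSucc_lt_last k)))
      rw [← this]
      congr! 1
      ext k
      refine Fin.lastCases ?_ (fun k => ?_) k <;> simp
    obtain ⟨h, hh, hc⟩ := ih fun t => c' fun k => f (t k + 1)
    refine ⟨fun m => f (h m + 1), fun a b hab => hmono (Nat.succ_lt_succ (hh hab)),
      fun i j hi hj => ?_⟩
    have hcast : StrictMono (Fin.castSucc : Fin n → Fin (n + 1)) := Fin.strictMono_castSucc
    exact (key _ (hh.comp hi)).trans ((hc _ _ (hi.comp hcast) (hj.comp hcast)).trans
      (key _ (hh.comp hj)).symm)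

end Ramsey

section Indiscernible

variable {L : FirstOrder.Language.{u, v}} {M : Type w} [L.Structure M] {T : L.Theory}
  {κ : Cardinal.{w}}

variable (L) in
/-- The sequence `s` of `α`-tuples is order indiscernible over `A`. -/
def IndiscernibleOver (A : Set M) {J : Type*} [LinearOrder J] {α : Type w} (s : J → α → M) :
    Prop :=
  ∀ (n : ℕ) (i j : Fin n → J), StrictMono i → StrictMono j → ∀ D, A.Definable L D →
    (fun p : Fin n × α => s (i p.1) p.2) ∈ D → (fun p : Fin n × α => s (j p.1) p.2) ∈ D

theorem IndiscernibleOver.comp {A : Set M} {I J : Type*} [LinearOrder I] [LinearOrder J]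
    {α : Type w} {s : J → α → M} (hs : IndiscernibleOver L A s) {e : I → J} (he : StrictMono e) :
    IndiscernibleOver L A (s ∘ e) :=
  fun n _ _ hi hj => hs n _ _ (he.comp hi) (he.comp hj)

theorem exists_strictMonoOn_nat {J : Type*} [LinearOrder J] (J₀ : Finset J) :
    ∃ g : J → ℕ, StrictMonoOn g J₀ := by
  refine ⟨fun j => (J₀.filter (· < j)).card, fun a ha b _ hab => Finset.card_lt_card ?_⟩
  refine Finset.ssubset_iff_of_subset (fun x hx => ?_) |>.2 ⟨a, ?_, ?_⟩
  · rw [Finset.mem_filter] at hx ⊢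
    exact ⟨hx.1, hx.2.trans hab⟩
  · exact Finset.mem_filter.2 ⟨ha, hab⟩
  · simp

/-- The standard lemma: every sequence has, along each small linear order, an indiscernible sequence
that realizes its Ehrenfeucht–Mostowski type. -/
theorem IsMonster.exists_indiscernibleOver (hM : IsMonster M T κ) {α J : Type w} [LinearOrder J]
    {A : Set M} (hα : #α < κ) (hJ : #J < κ) (hA : #A < κ) (x : ℕ → α → M) :
    ∃ s : J → α → M, IndiscernibleOver L A s ∧
      ∀ (n : ℕ) (D : Set (Fin n × α → M)), A.Definable L D →
        (∀ i : Fin n → ℕ, StrictMono i → (fun p : Fin n × α => x (i p.1) p.2) ∈ D) →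
          ∀ j : Fin n → J, StrictMono j → (fun p : Fin n × α => s (j p.1) p.2) ∈ D := by
  classical
  let 𝒟₁ : Set (Set (J × α → M)) := {C | ∃ (n : ℕ) (D : Set (Fin n × α → M)), A.Definable L D ∧
    ∃ i j : Fin n → J, StrictMono i ∧ StrictMono j ∧
      C = {z | z ∘ Prod.map i id ∈ D}ᶜ ∪ {z | z ∘ Prod.map j id ∈ D}}
  let 𝒟₂ : Set (Set (J × α → M)) := {C | ∃ (n : ℕ) (D : Set (Fin n × α → M)), A.Definable L D ∧
    (∀ i : Fin n → ℕ, StrictMono i → (fun p : Fin n × α => x (i p.1) p.2) ∈ D) ∧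
      ∃ j : Fin n → J, StrictMono j ∧ C = {z | z ∘ Prod.map j id ∈ D}}
  obtain ⟨z, hz⟩ := hM.exists_mem (mk_prod_lt hM.aleph0_lt.le hJ hα) hA (𝒟₁ ∪ 𝒟₂) (by
    rintro C (⟨n, D, hD, i, j, -, -, rfl⟩ | ⟨n, D, hD, -, j, -, rfl⟩)
    · exact (hD.preimage_comp _).compl.union (hD.preimage_comp _)
    · exact hD.preimage_comp _) (by
    -- a finite part is realized by a homogeneous subsequence of `x`
    have : ∀ F : Finset (Set (J × α → M)), (∀ C ∈ F, C ∈ 𝒟₁ ∪ 𝒟₂) →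
        ∃ (h : ℕ → ℕ) (J₀ : Finset J), StrictMono h ∧ ∀ g : J → ℕ, StrictMonoOn g J₀ →
          ∀ C ∈ F, (fun p : J × α => x (h (g p.1)) p.2) ∈ C := by
      intro F
      induction F using Finset.induction_on with
      | empty => exact fun _ => ⟨id, ∅, strictMono_id, by simp⟩
      | insert C F _ ih =>
        intro hF
        obtain ⟨h, J₀, hh, hJ₀⟩ := ih fun C hC => hF C (Finset.mem_insert_of_mem hC)
        rcases hF C (Finset.mem_insert_self _ _) with
          ⟨n, D, hD, i, j, hi, hj, rfl⟩ | ⟨n, D, hD, hx, j, hj, rfl⟩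
        · obtain ⟨h', hh', hc⟩ := exists_strictMono_homogeneous n
            fun t => (fun p : Fin n × α => x (h (t p.1)) p.2) ∈ D
          refine ⟨h ∘ h', J₀ ∪ (Finset.univ.image i ∪ Finset.univ.image j), hh.comp hh',
            fun g hg C hC => ?_⟩
          rcases Finset.mem_insert.1 hC with rfl | hC
          · have := hc (g ∘ i) (g ∘ j) (fun a b hab => hg (by simp) (by simp) (hi hab))
              (fun a b hab => hg (by simp) (by simp) (hj hab))
            by_cases hD' : (fun p : Fin n × α => x (h (h' (g (i p.1)))) p.2) ∈ D
            · exact Or.inr (this.1 hD')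
            · exact Or.inl hD'
          · exact hJ₀ (h' ∘ g) (fun a ha b hb hab => hh' (hg
              (by simp only [Finset.coe_union]; exact Or.inl ha)
              (by simp only [Finset.coe_union]; exact Or.inl hb) hab)) C hC
        · refine ⟨h, J₀ ∪ Finset.univ.image j, hh, fun g hg C hC => ?_⟩
          rcases Finset.mem_insert.1 hC with rfl | hC
          · exact hx (h ∘ g ∘ j) fun a b hab => hh (hg (by simp) (by simp) (hj hab))
          · exact hJ₀ g (hg.mono (by simp)) C hC
    intro F hF
    obtain ⟨h, J₀, -, hJ₀⟩ := this F fun C hC => hF hC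
    obtain ⟨g, hg⟩ := exists_strictMonoOn_nat J₀
    exact ⟨_, hJ₀ g hg⟩)
  refine ⟨fun j a => z (j, a), fun n i j hi hj D hD hiD => ?_, fun n D hD hx j hj =>
    hz _ (Or.inr ⟨n, D, hD, hx, j, hj, rfl⟩)⟩
  rcases hz _ (Or.inl ⟨n, D, hD, i, j, hi, hj, rfl⟩) with h | h
  exacts [(h hiD).elim, h]

/-- The standard lemma, with Ehrenfeucht–Mostowski types given by type-definable sets. -/
theorem IsMonster.exists_indiscernibleOver_typeDefinable (hM : IsMonster M T κ) {α J : Type w}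
    [LinearOrder J] {A : Set M} (hα : #α < κ) (hJ : #J < κ) (hA : #A < κ) (x : ℕ → α → M) :
    ∃ s : J → α → M, IndiscernibleOver L A s ∧
      (∀ S : Set (α → M), TypeDefinable L A S → (∀ i, x i ∈ S) → ∀ j, s j ∈ S) ∧
      ∀ S : Set (α ⊕ α → M), TypeDefinable L A S → (∀ i i', i < i' → Sum.elim (x i) (x i') ∈ S) →
        ∀ j j', j < j' → Sum.elim (s j) (s j') ∈ S := by
  obtain ⟨s, hs, hEM⟩ := hM.exists_indiscernibleOver hα hJ hA x
  refine ⟨s, hs, fun S hS hx j => ?_, fun S hS hx j j' hj => ?_⟩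
  · refine typeDefinable_iff.1 hS _ fun D h1 h2 => ?_
    exact hEM 1 {z | (fun k => z (0, k)) ∈ D} (h1.preimage_comp fun k => (0, k))
      (fun i _ => h2 (hx (i 0))) (fun _ => j) (Subsingleton.strictMono _)
  · refine typeDefinable_iff.1 hS _ fun D h1 h2 => ?_
    have hcomp : ∀ z : Fin 2 × α → M, z ∘ Sum.elim (fun k => (0, k)) (fun k => (1, k)) =
        Sum.elim (fun k => z (0, k)) (fun k => z (1, k)) := fun z => by ext (k | k) <;> rfl
    have := hEM 2 {z | z ∘ Sum.elim (fun k => (0, k)) (fun k => (1, k)) ∈ D}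
      (h1.preimage_comp _) (fun i hi => ?_) ![j, j']
      (by simpa [Fin.strictMono_iff_lt_succ] using hj)
    · rw [Set.mem_ofPred_eq, hcomp] at this
      exact this
    · rw [Set.mem_ofPred_eq, hcomp]
      exact h2 (hx (i 0) (i 1) (hi (by simp)))

/-- A definable set in arbitrarily many variables depends on finitely many of them only. -/
theorem Definable.exists_finset {A : Set M} {γ : Type*} {D : Set (γ → M)} (hD : A.Definable L D) :
    ∃ (V : Finset γ) (D' : Set (V → M)), A.Definable L D' ∧ D = {x | (fun v : V => x v) ∈ D'} := by
  classical
  obtain ⟨φ, rfl⟩ := hD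
  refine ⟨φ.freeVarFinset, _, ⟨φ.restrictFreeVar id, rfl⟩, ?_⟩
  ext x
  exact (Language.BoundedFormula.realize_restrictFreeVar' (Set.Subset.rfl)).symm

/-- Two subfamilies, indexed in the same order, of a sequence that is indiscernible over `A` are
conjugate over `A`. -/
theorem IsMonster.exists_equiv_of_indiscernibleOver (hM : IsMonster M T κ) {α K : Type w}
    {J : Type*} [LinearOrder J] {A : Set M} (hα : #α < κ) (hK : #K < κ) (hA : #A < κ)
    {s : J → α → M} (hs : IndiscernibleOver L A s) (f g : K → J)
    (hfg : ∀ k l, f k < f l ↔ g k < g l) :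
    ∃ σ : M ≃[L] M, (∀ a ∈ A, σ a = a) ∧ ∀ k i, σ (s (f k) i) = s (g k) i := by
  classical
  obtain ⟨σ, hσ, h⟩ := hM.exists_equiv (mk_prod_lt hM.aleph0_lt.le hK hα) hA
    (fun p : K × α => s (f p.1) p.2) (fun p => s (g p.1) p.2) (by
      intro D hD hfD
      obtain ⟨V, D', hD', rfl⟩ := Definable.exists_finset hD
      -- `e` lists the finitely many values of `f` that matter
      let J₀ : Finset J := V.image fun p => f p.1
      let e := J₀.orderIsoOfFin rfl
      have hmem : ∀ m, ∃ k : K, f k = e m := fun m => by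
        obtain ⟨p, -, hp⟩ := Finset.mem_image.1 (e m).2
        exact ⟨p.1, hp⟩
      choose k hk using hmem
      have hfk : StrictMono (f ∘ k) := fun a b hab => by
        simp only [Function.comp, hk]
        exact e.strictMono hab
      have hgk : StrictMono (g ∘ k) := fun a b hab => (hfg _ _).1 (hfk hab)
      let m : V → Fin J₀.card := fun p =>
        e.symm ⟨f p.1.1, Finset.mem_image_of_mem (fun p : K × α => f p.1) p.2⟩
      have hfm : ∀ p : V, f (k (m p)) = f p.1.1 := fun p => by
        rw [hk]; simp [m]
      have hgm : ∀ p : V, g (k (m p)) = g p.1.1 := fun p =>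
        le_antisymm (not_lt.1 fun h => (hfm p).not_gt ((hfg _ _).2 h))
          (not_lt.1 fun h => (hfm p).not_lt ((hfg _ _).2 h))
      have := hs _ _ _ hfk hgk _ (hD'.preimage_comp fun p : V => (m p, p.1.2)) (by
        change (fun v : V => s (f (k (m v))) v.1.2) ∈ D'
        simp only [hfm]
        exact hfD)
      change (fun v : V => s (g (k (m v))) v.1.2) ∈ D' at this
      simp only [hgm] at this
      exact this)
  exact ⟨σ, hσ, fun k i => h (k, i)⟩

/-- A sequence that is indiscernible over `A` stays indiscernible over the empty set when the
elements of `A` are appended to each of its terms. -/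
theorem IndiscernibleOver.indiscernible {A : Set M} {J I : Type*} [LinearOrder J] [LinearOrder I]
    {α : Type w} {s : J → α → M} (hs : IndiscernibleOver L A s) {e : I → J} (he : StrictMono e) :
    Indiscernible L fun i => (Sum.elim (s (e i)) (↑) : α ⊕ A → M) := by
  intro n i j hi hj φ
  have hd : A.Definable L {z : Fin n × α → M | φ.Realize
      fun p => (Sum.elim (fun k => z (p.1, k)) (↑) : α ⊕ A → M) p.2} := by
    convert definable_of_formula (A := A) (φ.relabel
      fun p => Sum.elim (fun k => Sum.inr (p.1, k)) Sum.inl p.2 : L.Formula (A ⊕ (Fin n × α)))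
      (↑) (fun a => a.2) using 1
    ext z
    simp only [Set.mem_ofPred_eq, Language.Formula.realize_relabel]
    rw [iff_iff_eq]
    congr 1
    ext ⟨m, k | a⟩ <;> rfl
  exact ⟨hs n _ _ (he.comp hi) (he.comp hj) _ hd, hs n _ _ (he.comp hj) (he.comp hi) _ hd⟩

theorem IndiscernibleOver.indiscernible_comp {A : Set M} {J I : Type*} [LinearOrder J]
    [LinearOrder I] {α β : Type w} {s : J → α → M} (hs : IndiscernibleOver L A s) {e : I → J}
    (he : StrictMono e) (f : β → α) : Indiscernible L fun i k => s (e i) (f k) := by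
  intro n i j hi hj φ
  have hd : A.Definable L {z : Fin n × α → M | φ.Realize (z ∘ Prod.map id f)} :=
    (((Set.empty_definable_iff (L := L)).2 ⟨φ, rfl⟩).mono (Set.empty_subset A)).preimage_comp _
  exact ⟨hs n _ _ (he.comp hi) (he.comp hj) _ hd, hs n _ _ (he.comp hj) (he.comp hi) _ hd⟩

/-- In an indiscernible sequence of tuples that all end with an enumeration of `A`, any two pairs of
terms, taken in increasing order, are in the same `A`-definable sets. -/
theorem Indiscernible.elim_mem {A : Set M} {I : Type*} [LinearOrder I] {α : Type w}
    {s : I → α ⊕ A → M} (hs : Indiscernible L s) (hA : ∀ i a, s i (Sum.inr a) = a)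
    {D : Set (α ⊕ α → M)} (hD : A.Definable L D) {i j i' j' : I} (hij : i < j) (hij' : i' < j')
    (h : Sum.elim (fun k => s i (Sum.inl k)) (fun k => s j (Sum.inl k)) ∈ D) :
    Sum.elim (fun k => s i' (Sum.inl k)) (fun k => s j' (Sum.inl k)) ∈ D := by
  obtain ⟨φ, rfl⟩ := Set.definable_iff_exists_formula_sum.1 hD
  have key := hs 2 ![i, j] ![i', j'] (by simpa [Fin.strictMono_iff_lt_succ] using hij)
    (by simpa [Fin.strictMono_iff_lt_succ] using hij')
    (φ.relabel (Sum.elim (fun a => (0, Sum.inr a))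
      (Sum.elim (fun k => (0, Sum.inl k)) (fun k => (1, Sum.inl k)))))
  have hcomp : ∀ i j : I, ((fun p : Fin 2 × (α ⊕ A) => s (![i, j] p.1) p.2) ∘
      (Sum.elim (fun a => (0, Sum.inr a))
        (Sum.elim (fun k => (0, Sum.inl k)) (fun k => (1, Sum.inl k))))) =
      Sum.elim (↑) (Sum.elim (fun k => s i (Sum.inl k)) (fun k => s j (Sum.inl k))) := by
    intro i j
    ext (a | k | k)
    exacts [hA i a, rfl, rfl]
  rw [Language.Formula.realize_relabel, Language.Formula.realize_relabel, hcomp, hcomp] at key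
  exact key.1 h

theorem Indiscernible.map {I : Type*} [LinearOrder I] {α : Type w} {s : I → α → M}
    (hs : Indiscernible L s) (σ : M ≃[L] M) : Indiscernible L fun i k => σ (s i k) := by
  intro n i j hi hj φ
  exact (Language.StrongHomClass.realize_formula σ φ).trans ((hs n i j hi hj φ).trans
    (Language.StrongHomClass.realize_formula σ φ).symm)

end Indiscernible

/-! ### Bounded equivalence relations -/

section Bounded

variable {L : FirstOrder.Language.{u, v}} {M : Type w} [L.Structure M] {T : L.Theory}
  {κ : Cardinal.{w}} {ι : Type w} {A : Set M} {X : Set (ι → M)} {E : Setoid X}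

theorem IsMonster.mk_definable_lt (hM : IsMonster M T κ) {α : Type w} (hα : #α < κ) (hA : #A < κ) :
    #{D : Set (α → M) // A.Definable L D} < κ := by
  have hsurj : Function.Surjective (fun φ : L.Formula (A ⊕ α) =>
      (⟨{x | φ.Realize (Sum.elim (↑) x)}, Set.definable_iff_exists_formula_sum.2 ⟨_, rfl⟩⟩ :
        {D : Set (α → M) // A.Definable L D})) := by
    rintro ⟨D, hD⟩
    obtain ⟨φ, rfl⟩ := Set.definable_iff_exists_formula_sum.1 hD
    exact ⟨φ, rfl⟩
  have h1 : lift.{max u v} #{D : Set (α → M) // A.Definable L D} ≤ #(L.Formula (A ⊕ α)) := by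
    simpa using mk_le_of_surjective (Equiv.ulift.{max u v}.symm.surjective.comp hsurj)
  have h2 : #(L.Formula (A ⊕ α)) ≤ #(Σ n, L.BoundedFormula (A ⊕ α) n) :=
    mk_le_of_injective (f := fun φ => ⟨0, φ⟩)
      (sigma_mk_injective (β := fun n => L.BoundedFormula (A ⊕ α) n))
  have h3 : max ℵ₀ (lift.{max u v} #(A ⊕ α) + lift.{w} L.card) < lift.{max u v} κ :=
    max_lt (by simpa using hM.aleph0_lt) (add_lt_of_lt (by simpa using hM.aleph0_lt.le)
      (lift_lt.2 (mk_sum_lt hM.aleph0_lt.le hA hα)) hM.card_lt)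
  exact lift_lt.1 ((h1.trans (h2.trans Language.BoundedFormula.card_le)).trans_lt h3)

/-- The graph of `E`, as a set of tuples of elements of `M`. -/
def relSet (E : Setoid X) : Set (ι ⊕ ι → M) := {z | ∃ x y : X, E x y ∧ z = Sum.elim x.1 y.1}

theorem elim_mem_relSet {x y : X} : Sum.elim x.1 y.1 ∈ relSet E ↔ E x y := by
  constructor
  · rintro ⟨x', y', h, h'⟩
    obtain rfl : x = x' := Subtype.ext (funext fun k => congrFun h' (Sum.inl k))
    obtain rfl : y = y' := Subtype.ext (funext fun k => congrFun h' (Sum.inr k))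
    exact h
  · exact fun h => ⟨x, y, h, rfl⟩

theorem exists_of_mem_relSet {x y : ι → M} (h : Sum.elim x y ∈ relSet E) :
    ∃ (hx : x ∈ X) (hy : y ∈ X), E ⟨x, hx⟩ ⟨y, hy⟩ := by
  obtain ⟨x', y', h, h'⟩ := h
  obtain rfl : x = x' := funext fun k => congrFun h' (Sum.inl k)
  obtain rfl : y = y' := funext fun k => congrFun h' (Sum.inr k)
  exact ⟨x'.2, y'.2, h⟩

variable (L A E) in
/-- Every definable set `D` containing the graph of `E` covers `X` by finitely many of its fibres
`D(f, ·)`. For a hyperdefinable set this says that `E` is bounded. -/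
def HasFiniteCovers : Prop :=
  ∀ D, A.Definable L D → relSet E ⊆ D →
    ∃ F : Finset X, ∀ x : X, ∃ f ∈ F, Sum.elim f.1 x.1 ∈ D

/-- If finitely many fibres of `D` do not suffice to cover `X`, then `X` contains indiscernible
sequences of any small order type whose terms are pairwise unrelated by `D`. -/
theorem IsMonster.exists_indiscernibleOver_of_not_cover (hM : IsMonster M T κ) (hι : #ι < κ)
    (hA : #A < κ) (hX : TypeDefinable L A X) {D : Set (ι ⊕ ι → M)} (hD : A.Definable L D)
    (hcov : ¬ ∃ F : Finset X, ∀ x : X, ∃ f ∈ F, Sum.elim f.1 x.1 ∈ D)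
    (J : Type w) [LinearOrder J] (hJ : #J < κ) :
    ∃ s : J → ι → M, IndiscernibleOver L A s ∧ (∀ j, s j ∈ X) ∧
      ∀ i j, i < j → Sum.elim (s i) (s j) ∉ D := by
  push Not at hcov
  obtain ⟨x, -, hx⟩ := exists_seq_of_forall_finset_exists (fun _ : X => True)
    (fun x y => Sum.elim x.1 y.1 ∉ D) (fun F _ => by
      obtain ⟨y, hy⟩ := hcov F
      exact ⟨y, trivial, hy⟩)
  obtain ⟨s, hs, h1, h2⟩ := hM.exists_indiscernibleOver_typeDefinable (J := J) hι hJ hA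
    fun i => (x i).1
  exact ⟨s, hs, h1 X hX fun i => (x i).2, h2 Dᶜ (.of_definable hD.compl) hx⟩

theorem IsMonster.hasFiniteCovers_of_isBounded (hM : IsMonster M T κ) (hι : #ι < κ)
    (hA : #A < κ) (hE : IsHyperdefinable L A E) (hb : IsBounded κ E) : HasFiniteCovers L A E := by
  intro D hD hED
  by_contra hcov
  -- a sequence that is longer than the number of classes
  obtain ⟨J, _, hJ⟩ : ∃ (J : Type w) (_ : LinearOrder J), #J = 2 ^ #(Quotient E) :=
    ⟨(2 ^ #(Quotient E) : Cardinal.{w}).ord.ToType, inferInstance, mk_ord_toType _⟩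
  obtain ⟨s, -, hsX, hs⟩ := hM.exists_indiscernibleOver_of_not_cover hι hA hE.set hD hcov J (by
    rw [hJ]
    exact hM.strongLimit.isStrongPrelimit hb)
  have hne : ∀ i j, i < j → Quotient.mk E ⟨s i, hsX i⟩ ≠ Quotient.mk E ⟨s j, hsX j⟩ :=
    fun i j hij h => hs i j hij (hED
      ((elim_mem_relSet (x := ⟨s i, hsX i⟩) (y := ⟨s j, hsX j⟩)).2 (Quotient.exact h)))
  refine (cantor #(Quotient E)).not_ge (hJ ▸ mk_le_of_injective
    (f := fun j => Quotient.mk E ⟨s j, hsX j⟩) fun i j h => ?_)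
  rcases lt_trichotomy i j with hij | hij | hij
  exacts [(hne i j hij h).elim, hij, (hne j i hij h.symm).elim]

/-- Two elements of `X` are equivalent if for each definable set `D` containing the graph of `E`
their classes meet a common fibre of `D`. -/
theorem IsMonster.rel_of_forall_definable (hM : IsMonster M T κ) (hι : #ι < κ) (hA : #A < κ)
    (hE : IsHyperdefinable L A E) (x₀ y₀ : X)
    (h : ∀ D, A.Definable L D → relSet E ⊆ D → ∃ x y z : X, E x x₀ ∧ E y y₀ ∧
      Sum.elim z.1 x.1 ∈ D ∧ Sum.elim z.1 y.1 ∈ D) : E x₀ y₀ := by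
  have hκ := hM.aleph0_lt.le
  let B : Set M := A ∪ (Set.range x₀.1 ∪ Set.range y₀.1)
  have hB : #B < κ := (mk_union_le _ _).trans_lt (add_lt_of_lt hκ hA ((mk_union_le _ _).trans_lt
    (add_lt_of_lt hκ (mk_range_le.trans_lt hι) (mk_range_le.trans_lt hι))))
  have hAB : A ⊆ B := Set.subset_union_left
  have hrel : TypeDefinable L A (relSet E) := hE.rel
  -- the variables are a triple `(z, x, y)`
  obtain ⟨t, ⟨htx, hty⟩, ht⟩ := hM.exists_comp_mem (A := A) (B := B) (S := relSet E)
    (β := ι ⊕ (ι ⊕ ι)) (mk_sum_lt hκ hι (mk_sum_lt hκ hι hι)) hB hAB hrel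
    (T' := {t | Sum.elim x₀.1 t ∘ Sum.elim (fun k => Sum.inr (Sum.inr (Sum.inl k))) Sum.inl
        ∈ relSet E} ∩
      {t | Sum.elim y₀.1 t ∘ Sum.elim (fun k => Sum.inr (Sum.inr (Sum.inr k))) Sum.inl ∈ relSet E})
    ((hrel.fix hAB _ _ fun k => Or.inr (Or.inl ⟨k, rfl⟩)).inter
      (hrel.fix hAB _ _ fun k => Or.inr (Or.inr ⟨k, rfl⟩)))
    (fun b : Bool => Sum.elim Sum.inl fun k => Sum.inr (if b then Sum.inl k else Sum.inr k)) (by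
      intro D hD hED
      obtain ⟨x, y, z, hx, hy, hzx, hzy⟩ := h D hD hED
      refine ⟨Sum.elim z (Sum.elim x y), ⟨?_, ?_⟩, ?_⟩
      · exact ⟨x, x₀, hx, by ext (k | k) <;> rfl⟩
      · exact ⟨y, y₀, hy, by ext (k | k) <;> rfl⟩
      · rintro (_ | _)
        · convert hzy using 1
          ext (k | k) <;> rfl
        · convert hzx using 1
          ext (k | k) <;> rfl)
  have aux : ∀ {z : ι ⊕ ι → M}, z ∈ relSet E →
      ∃ (hx : z ∘ Sum.inl ∈ X) (hy : z ∘ Sum.inr ∈ X), E ⟨_, hx⟩ ⟨_, hy⟩ := fun {z} hz =>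
    exists_of_mem_relSet (by rwa [Sum.elim_comp_inl_inr])
  obtain ⟨_, _, h1⟩ := aux htx
  obtain ⟨_, _, h2⟩ := aux hty
  obtain ⟨_, _, h3⟩ := aux (ht true)
  obtain ⟨_, _, h4⟩ := aux (ht false)
  exact E.trans (E.trans (E.symm h1) (E.symm h3)) (E.trans h4 h2)

/-- A hyperdefinable set with finite covers has at most `2 ^ (μ * ℵ₀)` elements, where `μ` is the
number of `A`-definable sets of pairs: an element is determined by the fibres that contain it in the
finite covers. The bound does not depend on `E`. -/
theorem IsMonster.mk_quotient_le (hM : IsMonster M T κ) (hι : #ι < κ) (hA : #A < κ)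
    (hE : IsHyperdefinable L A E) (hcov : HasFiniteCovers L A E) :
    #(Quotient E) ≤ #(Set ({D : Set (ι ⊕ ι → M) // A.Definable L D} × ℕ)) := by
  rcases isEmpty_or_nonempty X with hX | hX
  · have : IsEmpty (Quotient E) := Quotient.instIsEmpty
    simp
  have henum : ∀ D : {D : Set (ι ⊕ ι → M) // A.Definable L D}, ∃ e : ℕ → X, relSet E ⊆ D.1 →
      ∀ x : X, ∃ n, Sum.elim (e n).1 x.1 ∈ D.1 := by
    intro D
    by_cases hED : relSet E ⊆ D.1
    · obtain ⟨F, hF⟩ := hcov D.1 D.2 hED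
      have hne : (F : Set X).Nonempty := let ⟨f, hf, _⟩ := hF hX.some; ⟨f, hf⟩
      obtain ⟨e, he⟩ := F.countable_toSet.exists_eq_range hne
      refine ⟨e, fun _ x => ?_⟩
      obtain ⟨f, hf, hfx⟩ := hF x
      obtain ⟨n, rfl⟩ := (he ▸ hf : f ∈ Set.range e)
      exact ⟨n, hfx⟩
    · exact ⟨fun _ => hX.some, fun h => (hED h).elim⟩
  choose e he using henum
  -- `e D` lists the base points of the fibres of `D` that cover `X`
  refine mk_le_of_injective (f := fun q : Quotient E =>
    {p : {D : Set (ι ⊕ ι → M) // A.Definable L D} × ℕ |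
      Sum.elim (e p.1 p.2).1 q.out.1 ∈ p.1.1}) fun q q' hq => ?_
  rw [← q.out_eq, ← q'.out_eq]
  refine Quotient.sound (hM.rel_of_forall_definable hι hA hE _ _ fun D hD hED => ?_)
  obtain ⟨n, hn⟩ := he ⟨D, hD⟩ hED q.out
  exact ⟨_, _, e ⟨D, hD⟩ n, E.refl _, E.refl _, hn,
    (Set.ext_iff.1 hq (⟨D, hD⟩, n)).1 hn⟩

theorem IsMonster.mk_set_definable_lt (hM : IsMonster M T κ) {α : Type w} (hα : #α < κ)
    (hA : #A < κ) : #(Set ({D : Set (α → M) // A.Definable L D} × ℕ)) < κ := by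
  rw [mk_set]
  refine hM.strongLimit.isStrongPrelimit ?_
  rw [mk_prod, mk_nat, lift_aleph0, lift_uzero]
  exact mul_lt_of_lt hM.aleph0_lt.le (hM.mk_definable_lt hα hA) hM.aleph0_lt

theorem IsMonster.isBounded_of_hasFiniteCovers (hM : IsMonster M T κ) (hι : #ι < κ) (hA : #A < κ)
    (hE : IsHyperdefinable L A E) (hcov : HasFiniteCovers L A E) : IsBounded κ E :=
  (hM.mk_quotient_le hι hA hE hcov).trans_lt
    (hM.mk_set_definable_lt (mk_sum_lt hM.aleph0_lt.le hι hι) hA)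

theorem IsHyperdefinable.map_rel (hE : IsHyperdefinable L A E) {σ : M ≃[L] M}
    (hσ : ∀ a ∈ A, σ a = a) {x y : X} (h : E x y) :
    Sum.elim (fun k => σ (x.1 k)) (fun k => σ (y.1 k)) ∈ relSet E := by
  have hrel : TypeDefinable L A (relSet E) := hE.rel
  convert hrel.map_mem hσ (elim_mem_relSet.2 h) using 1
  ext (k | k) <;> rfl

/-- For `E` with finite covers, two classes are equal if the pair of them is conjugate to each pair
of terms, taken in increasing order, of some infinite sequence. -/
theorem IsMonster.rel_of_seq (hM : IsMonster M T κ) (hι : #ι < κ) (hA : #A < κ)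
    (hE : IsHyperdefinable L A E) (hcov : HasFiniteCovers L A E) (x₀ y₀ : X) (x : ℕ → X)
    (hx : ∀ i j, i < j → ∃ σ : M ≃[L] M, (∀ a ∈ A, σ a = a) ∧
      Sum.elim (fun k => σ ((x i).1 k)) x₀.1 ∈ relSet E ∧
      Sum.elim (fun k => σ ((x j).1 k)) y₀.1 ∈ relSet E) : E x₀ y₀ := by
  refine hM.rel_of_forall_definable hι hA hE _ _ fun D hD hED => ?_
  obtain ⟨F, hF⟩ := hcov D hD hED
  choose f hfF hf using fun i => hF (x i)
  -- two terms of the sequence lie in the same fibre of `D`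
  obtain ⟨i, j, hij, hfij⟩ : ∃ i j, i < j ∧ f i = f j := by
    obtain ⟨i, j, hij, h⟩ := Finite.exists_ne_map_eq_of_infinite fun i => (⟨f i, hfF i⟩ : F)
    rcases hij.lt_or_gt with hij | hij
    exacts [⟨i, j, hij, congrArg Subtype.val h⟩, ⟨j, i, hij, congrArg Subtype.val h.symm⟩]
  obtain ⟨σ, hσ, h1, h2⟩ := hx i j hij
  obtain ⟨hx1, _, h1⟩ := exists_of_mem_relSet h1
  obtain ⟨hx2, _, h2⟩ := exists_of_mem_relSet h2
  have hD' : ∀ y z : ι → M, Sum.elim y z ∈ D →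
      Sum.elim (fun k => σ (y k)) (fun k => σ (z k)) ∈ D := fun y z h => by
    rw [show Sum.elim (fun k => σ (y k)) (fun k => σ (z k)) = fun k => σ (Sum.elim y z k) by
      ext (k | k) <;> rfl]
    exact Definable.map_mem hD hσ h
  exact ⟨_, _, ⟨fun k => σ ((f i).1 k), hE.set.map_mem hσ (f i).2⟩, h1, h2, hD' _ _ (hf i),
    hD' _ _ (hfij ▸ hf j)⟩

theorem IsMonster.isStable_of_isBounded (hM : IsMonster M T κ) (hι : #ι < κ) (hA : #A < κ)
    (hE : IsHyperdefinable L A E) (hb : IsBounded κ E) : IsStable L κ A E := by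
  have hcov := hM.hasFiniteCovers_of_isBounded hι hA hE hb
  intro β _ a b hab i j hij
  -- an automorphism that maps one class to another maps representatives to representatives
  have hmaps : ∀ (σ : M ≃[L] M), (∀ a ∈ A, σ a = a) → ∀ p q : Quotient E × (β → M),
      Maps σ E p q → Sum.elim (fun k => σ (p.1.out.1 k)) q.1.out.1 ∈ relSet E := by
    rintro σ hσ p q ⟨⟨x, y, hx, hy, hxy⟩, -⟩
    obtain ⟨h1, h2, h⟩ := exists_of_mem_relSet
      (hE.map_rel hσ (Quotient.exact ((Quotient.out_eq _).trans hx.symm)))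
    refine elim_mem_relSet (x := ⟨_, h1⟩).2 (E.trans h ?_)
    rw [show (⟨_, h2⟩ : X) = y from Subtype.ext (funext hxy)]
    exact Quotient.exact (hy.trans (Quotient.out_eq _).symm)
  have hconst : ∀ i j, i < j → a i = a j := by
    intro i j hij
    rw [← (a i).out_eq, ← (a j).out_eq]
    refine Quotient.sound (hM.rel_of_seq hι hA hE hcov _ _ (fun n => (a n).out) fun l m hlm => ?_)
    obtain ⟨σ, hσ, h⟩ := hab 2 ![l, m] ![i, j] (by simpa [Fin.strictMono_iff_lt_succ] using hlm)
      (by simpa [Fin.strictMono_iff_lt_succ] using hij)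
    exact ⟨σ, hσ, hmaps σ hσ _ _ (h 0), hmaps σ hσ _ _ (h 1)⟩
  have hij' : a i = a j := by
    rcases hij.lt_or_gt with hij | hij
    exacts [hconst i j hij, (hconst j i hij).symm]
  obtain ⟨σ, hσ, h⟩ := hab 1 (fun _ => j) (fun _ => i) (Subsingleton.strictMono _)
    (Subsingleton.strictMono _)
  refine ⟨σ, hσ, fun _ => ?_⟩
  have := h 0
  simp only [hij'] at this ⊢
  exact this

end Bounded

/-! ### Distality: stable quotients are bounded -/

section Distal

theorem strictMono_concat {I J Z : Type*} [LinearOrder I] [LinearOrder J] [LinearOrder Z]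
    {a : I → Z} {b : J → Z} (ha : StrictMono a) (hb : StrictMono b) (hab : ∀ i j, a i < b j) :
    StrictMono (concat a b) := by
  intro x y hxy
  induction x using Lex.rec with | _ x
  induction y using Lex.rec with | _ y
  rcases x with x | x <;> rcases y with y | y
  · exact ha (Sum.Lex.inl_lt_inl_iff.1 hxy)
  · exact hab x y
  · exact (Sum.Lex.not_inr_lt_inl hxy).elim
  · exact hb (Sum.Lex.inr_lt_inr_iff.1 hxy)

theorem concat_induction {I J Z : Type*} {a : I → Z} {b : J → Z} {P : Z → Prop}
    (ha : ∀ i, P (a i)) (hb : ∀ j, P (b j)) (k : I ⊕ₗ J) : P (concat a b k) := by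
  induction k using Lex.rec with | _ k
  rcases k with k | k
  exacts [ha k, hb k]

theorem concat_eq {I J Z : Type*} {a : I → Z} {b : J → Z} {f : I ⊕ₗ J → Z}
    (ha : ∀ i, f (toLex (Sum.inl i)) = a i) (hb : ∀ j, f (toLex (Sum.inr j)) = b j) :
    f = concat a b := by
  funext k
  induction k using Lex.rec with | _ k
  rcases k with k | k
  exacts [ha k, hb k]

/-- The rational numbers other than `0` and `1`: a dense order with Dedekind cuts at `0` and
at `1`. -/
abbrev Punctured : Type w := ULift.{w} {q : ℚ // q ≠ 0 ∧ q ≠ 1}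

instance : DenselyOrdered Punctured.{w} where
  dense a b hab := by
    obtain ⟨c, hc, hc'⟩ := ((Set.Ioo_infinite (show a.down.1 < b.down.1 from hab)).sdiff
      (Set.toFinite {0, 1})).nonempty
    simp only [Set.mem_insert_iff, Set.mem_singleton_iff, not_or] at hc'
    exact ⟨⟨c, hc'⟩, hc.1, hc.2⟩

/-- The cut of the punctured rational line at `r`. -/
def cutAt (r : ℚ) : Set Punctured.{w} := {q | q.down.1 < r}

theorem isDedekindCut_cutAt {r : ℚ} (hr : r = 0 ∨ r = 1) : IsDedekindCut (cutAt.{w} r) := by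
  have hlt : ∀ x : Punctured.{w}, x ∉ cutAt r → r < x.down.1 := by
    intro x hx
    refine lt_of_le_of_ne (not_lt.1 hx) ?_
    rcases hr with rfl | rfl
    exacts [x.down.2.1.symm, x.down.2.2.symm]
  have hmem : ∀ a b : ℚ, a < b → ∃ y : Punctured.{w}, a < y.down.1 ∧ y.down.1 < b := by
    intro a b hab
    obtain ⟨c, hc, hc'⟩ := ((Set.Ioo_infinite hab).sdiff (Set.toFinite {0, 1})).nonempty
    simp only [Set.mem_insert_iff, Set.mem_singleton_iff, not_or] at hc'
    exact ⟨⟨c, hc'⟩, hc.1, hc.2⟩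
  refine ⟨fun a b hba ha => lt_of_le_of_lt (show b.down.1 ≤ a.down.1 from hba) ha, ?_, ?_, ?_, ?_⟩
  · obtain ⟨y, -, hy⟩ := hmem (r - 1) r (by linarith)
    exact ⟨y, hy⟩
  · intro x hx
    obtain ⟨y, hy, hy'⟩ := hmem _ _ hx
    exact ⟨y, hy', hy⟩
  · obtain ⟨y, hy, -⟩ := hmem r (r + 1) (by linarith)
    exact ⟨y, not_lt.2 hy.le⟩
  · intro x hx
    obtain ⟨y, hy, hy'⟩ := hmem _ _ (hlt x hx)
    exact ⟨y, not_lt.2 hy.le, hy'⟩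

/-- The position in the order `ℕ∞ × ℚ` of the point `q` of the `m`-th copy of `ℚ`. The negative
parts of all copies are glued together, and so are their parts beyond `1`; in between, the intervals
`[0, 1)` of the copies follow one after another. -/
def pos (m : ℕ) (q : ℚ) : ℕ∞ ×ₗ ℚ :=
  toLex (if q < 0 then 0 else if q < 1 then (m : ℕ∞) + 1 else ⊤, q)

theorem pos_lt_pos_iff {m n m' n' : ℕ} (h : m < n ↔ m' < n') (h' : m = n ↔ m' = n') (q r : ℚ) :
    pos m q < pos n r ↔ pos m' q < pos n' r := by
  simp only [pos, Prod.Lex.toLex_lt_toLex]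
  have e1 : ∀ a b : ℕ, ((a : ℕ∞) + 1 < b + 1 ↔ a < b) := fun a b => by
    exact_mod_cast Nat.succ_lt_succ_iff
  have e2 : ∀ a b : ℕ, ((a : ℕ∞) + 1 = b + 1 ↔ a = b) := fun a b => by
    exact_mod_cast Nat.succ_inj
  have e3 : ∀ a : ℕ, (a : ℕ∞) + 1 ≠ ⊤ := fun a => by exact_mod_cast ENat.natCast_ne_top (a + 1)
  have e4 : ∀ a : ℕ, (a : ℕ∞) + 1 < ⊤ := fun a => lt_top_iff_ne_top.2 (e3 a)
  split_ifs <;> simp [e1, e2, e3, e4, h, h', (e3 _).symm, pos_iff_ne_zero]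

theorem strictMono_pos (m : ℕ) : StrictMono (pos m) := by
  intro q r hqr
  rw [pos_lt_pos_iff (m' := 0) (n' := 0) (by simp) (by simp)]
  simp only [pos, Prod.Lex.toLex_lt_toLex, hqr, and_true]
  split_ifs <;> first | linarith | simp

theorem pos_lt_of_neg {m n : ℕ} {q r : ℚ} (hq : q < 0) (hr : 0 ≤ r) : pos m q < pos n r := by
  simp only [pos, Prod.Lex.toLex_lt_toLex, hq, if_true, hr.not_gt, if_false]
  split_ifs <;> simp

theorem pos_lt_of_lt {m n : ℕ} (hmn : m < n) {q r : ℚ} (hq : q < 1) (hr : 0 ≤ r) :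
    pos m q < pos n r := by
  have h1 : (m : ℕ∞) + 1 < n + 1 := by exact_mod_cast Nat.succ_lt_succ hmn
  have h2 : (m : ℕ∞) + 1 < ⊤ := by exact_mod_cast ENat.natCast_lt_top (m + 1)
  simp only [pos, Prod.Lex.toLex_lt_toLex, hq, if_true, hr.not_gt, if_false]
  split_ifs <;> simp [h1, h2]

theorem pos_lt_of_one_le {m n : ℕ} {q r : ℚ} (hq : q < 1) (hr : 1 ≤ r) : pos m q < pos n r := by
  have h2 : (m : ℕ∞) + 1 < ⊤ := by exact_mod_cast ENat.natCast_lt_top (m + 1)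
  simp only [pos, Prod.Lex.toLex_lt_toLex, hq, if_true, hr.not_gt, if_false,
    (zero_lt_one.trans_le hr).not_gt]
  split_ifs <;> simp [h2]

variable {L : FirstOrder.Language.{u, v}} {M : Type w} [L.Structure M] {T : L.Theory}
  {κ : Cardinal.{w}} {ι : Type w} {A : Set M} {X : Set (ι → M)} {E : Setoid X}

/-- In a distal theory a stable hyperdefinable set is bounded: stability moves the class of a term
of an indiscernible sequence from one cut of a dense part of the sequence to another one, and by
distality representatives of this single class can be inserted into both cuts at once. -/
theorem IsMonster.isBounded_of_isStable (hM : IsMonster M T κ) (hdistal : IsDistal L M κ)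
    (hι : #ι < κ) (hA : #A < κ) (hE : IsHyperdefinable L A E) (hst : IsStable L κ A E) :
    IsBounded κ E := by
  refine hM.isBounded_of_hasFiniteCovers hι hA hE fun D hD hED => ?_
  by_contra hcov
  have hκ := hM.aleph0_lt
  -- a long indiscernible sequence in `X` of pairwise unrelated elements
  obtain ⟨s', hs', hs'X, hs'D⟩ := hM.exists_indiscernibleOver_of_not_cover hι hA hE.set hD hcov
    (ULift.{w} (ℕ∞ ×ₗ ℚ)) (by
      have : Countable (ℕ∞ ×ₗ ℚ) := inferInstanceAs (Countable (ℕ∞ × ℚ))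
      exact mk_lt_of_countable hκ)
  have hup : StrictMono (ULift.up.{w} : ℕ∞ ×ₗ ℚ → _) := fun _ _ h => h
  let s : ℕ∞ ×ₗ ℚ → ι → M := s' ∘ ULift.up
  have hs : IndiscernibleOver L A s := hs'.comp hup
  have hsX : ∀ j, s j ∈ X := fun j => hs'X _
  have hsD : ∀ i j, i < j → Sum.elim (s i) (s j) ∉ D := fun i j hij => hs'D _ _ (hup hij)
  -- the classes of the `s (pos m 0)`, together with the rest of the `m`-th copy of `ℚ`
  obtain ⟨σ, hσ, hmap⟩ := hst (Punctured.{w} × ι) (mk_prod_lt hκ.le (mk_lt_of_countable hκ) hι)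
    (fun m => Quotient.mk E ⟨s (pos m 0), hsX _⟩) (fun m p => s (pos m p.1.down.1) p.2) (by
      intro n i j hi hj
      obtain ⟨σ, hσ, h⟩ := hM.exists_equiv_of_indiscernibleOver (K := ULift.{w} (Fin n × ℚ)) hι
        (mk_lt_of_countable hκ) hA hs (fun k => pos (i k.down.1) k.down.2)
        (fun k => pos (j k.down.1) k.down.2) (fun k l => pos_lt_pos_iff
          (hi.lt_iff_lt.trans hj.lt_iff_lt.symm)
          (hi.injective.eq_iff.trans hj.injective.eq_iff.symm) _ _)
      exact ⟨σ, hσ, fun k => ⟨⟨_, _, rfl, rfl, h ⟨k, 0⟩⟩, fun p => h ⟨k, p.1.down.1⟩ p.2⟩⟩)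
    0 1 zero_ne_one
  obtain ⟨⟨x, y, hx, hy, hxy⟩, hb⟩ := hmap ()
  dsimp only at hx hy hb
  -- `c` is the image of the term at `pos 0 0`; it is equivalent to the term at `pos 1 0`
  let c : ι → M := fun k => σ (s (pos 0 0) k)
  have hc : Sum.elim c (s (pos 1 0)) ∈ D := by
    obtain ⟨h1, h2, h⟩ := exists_of_mem_relSet
      (hE.map_rel hσ (x := ⟨s (pos 0 0), hsX _⟩) (Quotient.exact hx.symm))
    rw [show (⟨_, h2⟩ : X) = y from Subtype.ext (funext hxy)] at h
    exact hED (elim_mem_relSet.2 (E.trans h (Quotient.exact hy)))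
  -- the base sequence
  let a : Punctured.{w} → ι ⊕ A → M := fun q => Sum.elim (s (pos 0 q.down.1)) (↑)
  have hdown : StrictMono fun q : Punctured.{w} => q.down.1 := fun _ _ h => h
  have ha : Indiscernible L a := hs.indiscernible ((strictMono_pos 0).comp hdown)
  have hpart : ∀ (m : ℕ) (C : Set Punctured.{w}), StrictMono fun q : C => pos m q.1.down.1 :=
    fun m C _ _ h => strictMono_pos m h
  have hsingle : ∀ p : ℕ∞ ×ₗ ℚ, StrictMono (single p) := fun p _ _ h => (lt_irrefl _ h).elim
  have hnot : ∀ r : ℚ, ∀ q : ((cutAt.{w} r)ᶜ : Set Punctured.{w}), r ≤ q.1.down.1 :=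
    fun r q => not_lt.1 q.2
  -- apply `σ` to the sequence of the first copy with the term at `pos 0 0` inserted at `0`
  have hfill₁ : Fills L a (cutAt 0) (Sum.elim c (↑)) := by
    have h := (hs.indiscernible (strictMono_concat (hpart 1 (cutAt 0)) (strictMono_concat
      (hsingle (pos 0 0)) (hpart 1 (cutAt 0)ᶜ) ?_) ?_)).map σ
    · have hpt : ∀ q : Punctured.{w}, (fun k => σ ((Sum.elim (s (pos 1 q.down.1)) (↑) :
          ι ⊕ A → M) k)) = a q := by
        intro q
        ext (k | e)
        exacts [hb (q, k), hσ e e.2]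
      refine Eq.mp (congrArg (Indiscernible L) ?_) h
      refine concat_eq (fun q => hpt q) fun j => ?_
      induction j using Lex.rec with | _ j
      rcases j with _ | q
      · ext (k | e)
        exacts [rfl, hσ e e.2]
      · exact hpt q
    · exact fun _ q => pos_lt_of_lt zero_lt_one zero_lt_one (hnot 0 q)
    · exact fun q => concat_induction (fun _ => pos_lt_of_neg q.2 le_rfl)
        fun r => pos_lt_of_neg q.2 (hnot 0 r)
  -- the term at `pos 1 0` lies between the parts of the zeroth copy before and after `1`
  have hfill₂ : Fills L a (cutAt 1) (Sum.elim (s (pos 1 0)) (↑)) := by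
    have h := hs.indiscernible (strictMono_concat (hpart 0 (cutAt 1)) (strictMono_concat
      (hsingle (pos 1 0)) (hpart 0 (cutAt 1)ᶜ) ?_) ?_)
    · refine Eq.mp (congrArg (Indiscernible L) ?_) h
      refine concat_eq (fun q => rfl) fun j => ?_
      induction j using Lex.rec with | _ j
      rcases j with _ | q <;> rfl
    · exact fun _ q => pos_lt_of_one_le zero_lt_one (hnot 1 q)
    · exact fun q => concat_induction (fun _ => pos_lt_of_lt zero_lt_one q.2 le_rfl)
        fun r => pos_lt_of_one_le q.2 (hnot 1 r)
  have hneg : ∀ q : ℚ, q < 0 → ∃ r : cutAt.{w} 0, r.1.down.1 = q := fun q hq =>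
    ⟨⟨⟨q, hq.ne, (hq.trans zero_lt_one).ne⟩, hq⟩, rfl⟩
  have hins := hdistal (ι ⊕ A) Punctured.{w} (mk_sum_lt hκ.le hι hA) (mk_lt_of_countable hκ) a ha
    (cutAt 0) (cutAt 1) (isDedekindCut_cutAt (Or.inl rfl)) (isDedekindCut_cutAt (Or.inr rfl))
    ⟨fun q hq => lt_trans (show q.down.1 < 0 from hq) zero_lt_one, fun h => absurd
      (show (1 / 2 : ℚ) < 0 from @h ⟨1 / 2, by norm_num, by norm_num⟩
        (show (1 / 2 : ℚ) < 1 by norm_num)) (by norm_num)⟩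
    _ _ hfill₁ hfill₂
  -- the two inserted terms are related by `D`, and hence so are any two terms of the base sequence
  obtain ⟨p, hp⟩ := hneg (-2) (by norm_num)
  obtain ⟨r, hr⟩ := hneg (-1) (by norm_num)
  have hpr : p < r := show p.1.down.1 < r.1.down.1 by rw [hp, hr]; norm_num
  refine hsD _ _ (strictMono_pos 0 (show p.1.down.1 < r.1.down.1 from hpr)) ?_
  exact hins.elim_mem (by
      refine fun i e => ?_
      refine concat_induction (P := fun z : ι ⊕ A → M => z (Sum.inr e) = e) (fun _ => rfl) ?_ i
      refine concat_induction (P := fun z : ι ⊕ A → M => z (Sum.inr e) = e) (fun _ => rfl) ?_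
      refine concat_induction (P := fun z : ι ⊕ A → M => z (Sum.inr e) = e) (fun _ => rfl) ?_
      exact concat_induction (P := fun z : ι ⊕ A → M => z (Sum.inr e) = e) (fun _ => rfl)
        (fun _ => rfl)) hD
    (i := toLex (Sum.inr (toLex (Sum.inl ()))))
    (j := toLex (Sum.inr (toLex (Sum.inr (toLex (Sum.inr (toLex (Sum.inl ()))))))))
    (i' := toLex (Sum.inl p)) (j' := toLex (Sum.inl r))
    (Sum.Lex.inr_lt_inr_iff.2 (Sum.Lex.inl_lt_inr _ _)) (Sum.Lex.inl_lt_inl_iff.2 hpr) hc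

end Distal

/-! ### Type-definable groups and their components -/

section Groups

/-- The index of an intersection of preimages of subgroups is at most the product of the
indices. -/
theorem mk_quotient_iInf_comap_le {G S : Type w} [Group G] (f : S → G →* G) (K : S → Subgroup G) :
    #(Quotient (QuotientGroup.leftRel (⨅ s, (K s).comap (f s)))) ≤
      prod fun s => #(Quotient (QuotientGroup.leftRel (K s))) := by
  rw [← mk_pi]
  refine mk_le_of_injective (f := fun q s => Quotient.mk _ (f s q.out)) fun q q' h => ?_
  rw [← q.out_eq, ← q'.out_eq]
  refine Quotient.sound (QuotientGroup.leftRel_apply.2 (Subgroup.mem_iInf.2 fun s => ?_))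
  have := QuotientGroup.leftRel_apply.1 (Quotient.exact (congrFun h s))
  rw [Subgroup.mem_comap, map_mul, map_inv]
  exact this

variable {L : FirstOrder.Language.{u, v}} {M : Type w} [L.Structure M] {T : L.Theory}
  {κ : Cardinal.{w}} {ι : Type w} {A A₀ B : Set M} {G : Set (ι → M)} [Group G]

/-- The elements of a subgroup of `G`, as a set of tuples. -/
def tuples (H : Subgroup G) : Set (ι → M) := {x | ∃ h : G, h ∈ H ∧ h.1 = x}

theorem mem_tuples {H : Subgroup G} {g : G} : g.1 ∈ tuples H ↔ g ∈ H := by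
  constructor
  · rintro ⟨h, hh, hg⟩
    rwa [← Subtype.ext hg]
  · exact fun h => ⟨g, h, rfl⟩

variable (G) in
/-- The graph of the multiplication of `G`, as a set of tuples. -/
def mulSet : Set (ι ⊕ (ι ⊕ ι) → M) :=
  {z | ∃ x y : G, z = Sum.elim x.1 (Sum.elim y.1 (x * y).1)}

theorem exists_of_mem_mulSet {x y z : ι → M} (h : Sum.elim x (Sum.elim y z) ∈ mulSet G) :
    ∃ (hx : x ∈ G) (hy : y ∈ G), z = ((⟨x, hx⟩ * ⟨y, hy⟩ : G) : ι → M) := by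
  obtain ⟨x', y', h⟩ := h
  obtain rfl : x = x' := funext fun k => congrFun h (Sum.inl k)
  obtain rfl : y = y' := funext fun k => congrFun h (Sum.inr (Sum.inl k))
  exact ⟨x'.2, y'.2, funext fun k => congrFun h (Sum.inr (Sum.inr k))⟩

theorem IsTypeDefinableGroup.mono (hG : IsTypeDefinableGroup L G A₀) (h : A₀ ⊆ A) :
    IsTypeDefinableGroup L G A := ⟨hG.set.mono h, hG.mul.mono h⟩

/-- The action on `G` of an automorphism that fixes the parameters of `G`. -/
def IsTypeDefinableGroup.act (hG : IsTypeDefinableGroup L G A₀) (σ : M ≃[L] M)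
    (hσ : ∀ a ∈ A₀, σ a = a) : G →* G :=
  MonoidHom.mk' (fun x => ⟨fun k => σ (x.1 k), hG.set.map_mem hσ x.2⟩) (by
    intro x y
    have hmul : TypeDefinable L A₀ (mulSet G) := hG.mul
    have h := hmul.map_mem hσ ⟨x, y, rfl⟩
    rw [show (fun k => σ ((Sum.elim x.1 (Sum.elim y.1 (x * y).1) : ι ⊕ (ι ⊕ ι) → M) k)) =
      Sum.elim (fun k => σ (x.1 k)) (Sum.elim (fun k => σ (y.1 k)) fun k => σ ((x * y).1 k)) by
        ext (k | k | k) <;> rfl] at h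
    obtain ⟨_, _, h⟩ := exists_of_mem_mulSet h
    exact Subtype.ext h)

theorem IsMonster.isHyperdefinable_leftRel (hM : IsMonster M T κ) (hι : #ι < κ) (hA : #A < κ)
    (hG : IsTypeDefinableGroup L G A) {H : Subgroup G} (hH : TypeDefinableSubgroup L A H) :
    IsHyperdefinable L A (QuotientGroup.leftRel H) := by
  refine ⟨hG.set, ?_⟩
  have hκ := hM.aleph0_lt.le
  have hmul : TypeDefinable L A (mulSet G) := hG.mul
  have hH' : TypeDefinable L A (tuples H) := hH
  -- the graph is the set of the pairs `(x, y)` such that `x * h = y` for some `h` in `H`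
  convert hM.typeDefinable_image_comp (α := ι ⊕ ι) (mk_sum_lt hκ hι hι)
    (mk_sum_lt hκ hι (mk_sum_lt hκ hι hι)) hA
    (hmul.inter (hH'.preimage fun k => Sum.inr (Sum.inl k)))
    (Sum.elim Sum.inl fun k => Sum.inr (Sum.inr k)) using 1
  ext z
  constructor
  · rintro ⟨x, y, hxy, rfl⟩
    rw [QuotientGroup.leftRel_apply] at hxy
    refine ⟨Sum.elim x.1 (Sum.elim (x⁻¹ * y).1 y.1), ⟨⟨x, x⁻¹ * y, ?_⟩, ?_⟩, ?_⟩
    · rw [mul_inv_cancel_left]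
    · exact mem_tuples.2 hxy
    · ext (k | k) <;> rfl
  · rintro ⟨_, ⟨⟨x, h, rfl⟩, hh⟩, rfl⟩
    refine ⟨x, x * h, ?_, by ext (k | k) <;> rfl⟩
    rw [QuotientGroup.leftRel_apply, inv_mul_cancel_left]
    exact mem_tuples.1 hh

theorem TypeDefinableSubgroup.iInf (hG : TypeDefinable L A G) {S : Type*} {H : S → Subgroup G}
    (hH : ∀ s, TypeDefinableSubgroup L A (H s)) : TypeDefinableSubgroup L A (⨅ s, H s) := by
  have hH' : ∀ s, TypeDefinable L A (tuples (H s)) := hH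
  change TypeDefinable L A (tuples _)
  convert hG.inter (TypeDefinable.iInter hH') using 1
  ext x
  constructor
  · rintro ⟨h, hh, rfl⟩
    exact ⟨h.2, Set.mem_iInter.2 fun s => mem_tuples.2 (Subgroup.mem_iInf.1 hh s)⟩
  · rintro ⟨hx, hxH⟩
    exact ⟨⟨x, hx⟩, Subgroup.mem_iInf.2 fun s =>
      (mem_tuples (g := ⟨x, hx⟩)).1 (Set.mem_iInter.1 hxH s), rfl⟩

theorem TypeDefinableSubgroup.comap_act (hG : IsTypeDefinableGroup L G A₀) (hAB : A₀ ⊆ B)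
    {H : Subgroup G} (hH : TypeDefinableSubgroup L A H) (σ : M ≃[L] M) (hσ : ∀ a ∈ A₀, σ a = a)
    (hB : ∀ a ∈ A, σ.symm a ∈ B) : TypeDefinableSubgroup L B (H.comap (hG.act σ hσ)) := by
  have hH' : TypeDefinable L A (tuples H) := hH
  change TypeDefinable L B (tuples _)
  convert (hG.set.mono hAB).inter (hH'.preimage_equiv σ hB) using 1
  ext x
  constructor
  · rintro ⟨h, hh, rfl⟩
    exact ⟨h.2, (mem_tuples (g := hG.act σ hσ h)).2 hh⟩
  · rintro ⟨hx, hxH⟩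
    exact ⟨⟨x, hx⟩, (mem_tuples (g := hG.act σ hσ ⟨x, hx⟩)).1 hxH, rfl⟩

/-- The smallest type-definable subgroup of bounded index exists: there are few type-definable
subgroups, and the bound on their indices is uniform. -/
theorem IsMonster.exists_isG00 (hM : IsMonster M T κ) (hι : #ι < κ) (hA : #A < κ)
    (hG : IsTypeDefinableGroup L G A) : ∃ H : Subgroup G, IsG00 L κ A H := by
  let 𝒦 : Set (Subgroup G) :=
    {K | TypeDefinableSubgroup L A K ∧ IsBounded κ (QuotientGroup.leftRel K)}
  refine ⟨⨅ K : 𝒦, K.1, ⟨TypeDefinableSubgroup.iInf hG.set fun K => K.2.1, ?_⟩,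
    fun K hK => iInf_le (fun K : 𝒦 => K.1) ⟨K, hK⟩⟩
  have h𝒦 : #𝒦 < κ := by
    refine (mk_le_of_injective (β := Set {D : Set (ι → M) // A.Definable L D})
      (f := fun K => {D | tuples K.1 ⊆ D.1}) fun K K' h => ?_).trans_lt ?_
    · have hle : ∀ K K' : 𝒦, {D : {D : Set (ι → M) // A.Definable L D} | tuples K.1 ⊆ D.1} =
          {D | tuples K'.1 ⊆ D.1} → K.1 ≤ K'.1 := by
        intro K K' h g hg
        have hK' : TypeDefinable L A (tuples K'.1) := K'.2.1
        refine mem_tuples.1 (typeDefinable_iff.1 hK' _ fun D h1 h2 => ?_)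
        exact (Set.ext_iff.1 h ⟨D, h1⟩).2 h2 (mem_tuples.2 hg)
      exact Subtype.ext (le_antisymm (hle K K' h) (hle K' K h.symm))
    · rw [mk_set]
      exact hM.strongLimit.isStrongPrelimit (hM.mk_definable_lt hι hA)
  have hle := mk_quotient_iInf_comap_le (fun _ : 𝒦 => MonoidHom.id G) fun K => K.1
  simp only [Subgroup.comap_id] at hle
  refine hle.trans_lt (lt_of_le_of_lt (b := prod fun _ : 𝒦 =>
    #(Set ({D : Set (ι ⊕ ι → M) // A.Definable L D} × ℕ))) (prod_le_prod _ _ fun K => ?_) ?_)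
  · have hE := hM.isHyperdefinable_leftRel hι hA hG K.2.1
    exact hM.mk_quotient_le hι hA hE (hM.hasFiniteCovers_of_isBounded hι hA hE K.2.2)
  · rw [prod_const, lift_id, lift_id]
    exact power_lt_of_isStrongLimit hM.strongLimit
      (hM.mk_set_definable_lt (mk_sum_lt hM.aleph0_lt.le hι hι) hA) h𝒦

end Groups

/-! ### NIP: independence of the parameters -/

section NIP

variable {L : FirstOrder.Language.{u, v}} {M : Type w} [L.Structure M] {T : L.Theory}
  {κ : Cardinal.{w}} {ι : Type w} {A A₀ B : Set M} {G : Set (ι → M)} [Group G]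

/-- Compactness for the identity `K * K * K = K` of a type-definable subgroup `K`: every definable
set `D` containing `K` contains `K * D' * K` for some definable set `D'` containing `K`. -/
theorem IsMonster.exists_definable_mul_mul (hM : IsMonster M T κ) (hι : #ι < κ) (hA : #A < κ)
    (hG : IsTypeDefinableGroup L G A) {K : Subgroup G} (hK : TypeDefinableSubgroup L A K)
    {D : Set (ι → M)} (hD : A.Definable L D) (hKD : tuples K ⊆ D) :
    ∃ D', A.Definable L D' ∧ tuples K ⊆ D' ∧
      ∀ k ∈ K, ∀ l ∈ K, ∀ x : G, x.1 ∈ D' → (k * x * l).1 ∈ D := by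
  by_contra hcon
  push Not at hcon
  have hmul : TypeDefinable L A (mulSet G) := hG.mul
  have hK' : TypeDefinable L A (tuples K) := hK
  have hκ := hM.aleph0_lt
  have h5 : #(Fin 5 × ι) < κ := mk_prod_countable_lt hκ hι
  have htriple : ∀ (z : Fin 5 × ι → M) (a b c : Fin 5),
      (z ∘ Sum.elim (fun i => (a, i)) (Sum.elim (fun i => (b, i)) fun i => (c, i))) =
        Sum.elim (fun i => z (a, i)) (Sum.elim (fun i => z (b, i)) fun i => z (c, i)) := by
    intro z a b c
    ext (i | i | i) <;> rfl
  -- the variables are a tuple `(k, l, x, k * x, k * x * l)`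
  obtain ⟨z, ⟨⟨h023, h314⟩, ⟨h0, h1⟩, h4⟩, h2⟩ := hM.exists_comp_mem h5 hA subset_rfl hK'
    (((hmul.preimage (Sum.elim (fun i => ((0 : Fin 5), i))
        (Sum.elim (fun i => (2, i)) fun i => (3, i)))).inter
      (hmul.preimage (Sum.elim (fun i => ((3 : Fin 5), i))
        (Sum.elim (fun i => (1, i)) fun i => (4, i))))).inter
      (((hK'.preimage fun i => ((0 : Fin 5), i)).inter
        (hK'.preimage fun i => ((1 : Fin 5), i))).inter
        ((TypeDefinable.of_definable hD.compl).preimage fun i => ((4 : Fin 5), i))))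
    (fun _ : Unit => fun i => ((2 : Fin 5), i)) (by
      intro D' hD' hKD'
      obtain ⟨k, hk, l, hl, x, hx, hkxl⟩ := hcon D' hD' hKD'
      refine ⟨fun p => (![k, l, x, k * x, k * x * l] p.1).1 p.2,
        ⟨⟨?_, ?_⟩, ⟨mem_tuples.2 hk, mem_tuples.2 hl⟩, hkxl⟩, fun _ => hx⟩
      · rw [Set.mem_ofPred_eq, htriple]
        exact ⟨k, x, rfl⟩
      · rw [Set.mem_ofPred_eq, htriple]
        exact ⟨k * x, l, rfl⟩)
  rw [Set.mem_ofPred_eq, htriple] at h023 h314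
  obtain ⟨hk, hx, h3⟩ := exists_of_mem_mulSet h023
  obtain ⟨hkx, hl, h4'⟩ := exists_of_mem_mulSet h314
  have e : (⟨_, hkx⟩ : G) = ⟨_, hk⟩ * ⟨_, hx⟩ := Subtype.ext h3
  rw [e] at h4'
  refine h4 (hKD ?_)
  rw [Function.comp_def, h4']
  exact mem_tuples.2 (K.mul_mem (K.mul_mem (mem_tuples.1 h0) (mem_tuples.1 (h2 ())))
    (mem_tuples.1 h1))

/-- A sequence of elements of `G` that witnesses that infinitely many conjugates over `A₀` of the
bounded type-definable subgroup `K` are needed. The conjugate with index `j` is the preimage of `K`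
under the automorphism `σ j`; the images of `A` under the inverses of the `σ j`, together with the
`c j`, form a sequence that is indiscernible over `A₀`. -/
theorem IsMonster.exists_indiscernible_conjugates (hM : IsMonster M T κ) (hι : #ι < κ)
    (hA : #A < κ) (hA₀ : #A₀ < κ) (hG : IsTypeDefinableGroup L G A₀)
    {K : Subgroup G} (hK : TypeDefinableSubgroup L A K) {D : Set (ι → M)} (hD : A.Definable L D)
    (σ' : ℕ → {σ : M ≃[L] M // ∀ a ∈ A₀, σ a = a}) (g : ℕ → G)
    (hgD : ∀ i, (hG.act (σ' i).1 (σ' i).2 (g i)).1 ∉ D)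
    (hgK : ∀ i j, i < j → hG.act (σ' i).1 (σ' i).2 (g j) ∈ K) :
    ∃ (σ : ℤ → {σ : M ≃[L] M // ∀ a ∈ A₀, σ a = a}) (c : ℤ → G),
      IndiscernibleOver L A₀ (fun j => (Sum.elim (c j).1 (fun a => (σ j).1.symm a) : ι ⊕ A → M)) ∧
      (∀ j, (hG.act (σ j).1 (σ j).2 (c j)).1 ∉ D) ∧
      ∀ i j, i < j → hG.act (σ i).1 (σ i).2 (c j) ∈ K := by
  have hκ := hM.aleph0_lt
  have hK' : TypeDefinable L A (tuples K) := hK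
  obtain ⟨φD, rfl⟩ := Set.definable_iff_exists_formula_sum.1 hD
  have hform : ∀ {β : Type w} (φ : L.Formula (A ⊕ ι)) (f : A ⊕ ι → β),
      A₀.Definable L {z : β → M | φ.Realize (z ∘ f)} := fun φ f =>
    (((Set.empty_definable_iff (L := L)).2 ⟨φ, rfl⟩).mono (Set.empty_subset A₀)).preimage_comp f
  obtain ⟨s, hs, h1, h2⟩ := hM.exists_indiscernibleOver_typeDefinable (J := ULift.{w} ℤ)
    (mk_sum_lt hκ.le hι hA) (mk_lt_of_countable hκ) hA₀
    fun i => (Sum.elim (g i).1 (fun a => (σ' i).1.symm a) : ι ⊕ A → M)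
  -- the parts in `A` of the terms of the new sequence are conjugate to `A`
  have hconj : ∀ j, ∃ σ : M ≃[L] M, (∀ a ∈ A₀, σ a = a) ∧
      ∀ a : A, s j (Sum.inr a) = σ.symm a := by
    intro j
    obtain ⟨σ, hσ, h⟩ := hM.exists_equiv (A := A₀) (α := A) hA hA₀ (↑)
      (fun a => s j (Sum.inr a)) (fun C hC hAC => by
        refine h1 {z | z ∘ Sum.inr ∈ C} (TypeDefinable.of_definable (hC.preimage_comp _))
          (fun i => ?_) j
        exact Definable.map_mem hC (symm_fix (σ' i).2) hAC)
    exact ⟨σ.symm, symm_fix hσ, fun a => (h a).symm⟩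
  choose σ hσ hσs using hconj
  have hsG : ∀ j, (fun k => s j (Sum.inl k)) ∈ G :=
    h1 {z | z ∘ Sum.inl ∈ G} (hG.set.preimage _) fun i => (g i).2
  have hseq : ∀ j, s j = Sum.elim (fun k => s j (Sum.inl k)) (fun a : A => (σ j).symm a) := by
    intro j
    ext (k | a)
    exacts [rfl, hσs j a]
  refine ⟨fun j => ⟨σ ⟨j⟩, hσ ⟨j⟩⟩, fun j => ⟨_, hsG ⟨j⟩⟩, ?_, fun j => ?_, fun i j hij => ?_⟩
  · convert hs.comp (e := fun j : ℤ => ULift.up.{w} j) (fun _ _ h => h) using 2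
    exact (hseq _).symm
  · have := h1 {z | φD.Realize (z ∘ Sum.swap)}ᶜ (.of_definable (hform _ _).compl) (fun i h => by
      refine hgD i ((realize_elim_symm (σ' i).1 φD _).1 ?_)
      change φD.Realize _ at h
      convert h using 1
      ext (a | k) <;> rfl) ⟨j⟩
    refine fun h => this ?_
    rw [Set.mem_ofPred_eq, hseq]
    convert (realize_elim_symm (σ ⟨j⟩) φD _).2 h using 1
    ext (a | k) <;> rfl
  · refine mem_tuples.1 (typeDefinable_iff.1 hK' _ fun C hC hKC => ?_)
    obtain ⟨φ, rfl⟩ := Set.definable_iff_exists_formula_sum.1 hC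
    have := h2 {z | φ.Realize (z ∘ Sum.elim (fun a => Sum.inl (Sum.inr a))
      fun k => Sum.inr (Sum.inl k))} (.of_definable (hform _ _)) (fun i i' hi => by
        change φ.Realize _
        convert (realize_elim_symm (σ' i).1 φ _).2 (hKC (mem_tuples.2 (hgK i i' hi))) using 1
        ext (a | k) <;> rfl) ⟨i⟩ ⟨j⟩ hij
    refine (realize_elim_symm (σ ⟨i⟩) φ _).1 ?_
    rw [Set.mem_ofPred_eq, hseq ⟨i⟩] at this
    convert this using 1
    ext (a | k) <;> rfl

/-- Under NIP, finitely many conjugates over `A₀` of the bounded type-definable subgroup `K` suffice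
to bring their intersection into all conjugates of a given definable set `D` that contains `K`. -/
theorem IsMonster.exists_finset_conjugates (hM : IsMonster M T κ) (hNIP : IsNIP L M) (hι : #ι < κ)
    (hA : #A < κ) (hAA : A₀ ⊆ A) (hG : IsTypeDefinableGroup L G A₀) {K : Subgroup G}
    (hK : TypeDefinableSubgroup L A K) (hb : IsBounded κ (QuotientGroup.leftRel K))
    {D : Set (ι → M)} (hD : A.Definable L D) (hKD : tuples K ⊆ D) :
    ∃ F : Finset {σ : M ≃[L] M // ∀ a ∈ A₀, σ a = a}, ∀ x : G,
      (∀ τ ∈ F, hG.act τ.1 τ.2 x ∈ K) → ∀ σ : {σ : M ≃[L] M // ∀ a ∈ A₀, σ a = a},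
        (hG.act σ.1 σ.2 x).1 ∈ D := by
  classical
  by_contra hcon
  push Not at hcon
  have hκ := hM.aleph0_lt
  have hA₀ : #A₀ < κ := (mk_le_mk_of_subset hAA).trans_lt hA
  obtain ⟨f, hfD, hfK⟩ := exists_seq_of_forall_finset_exists
    (fun p : {σ : M ≃[L] M // ∀ a ∈ A₀, σ a = a} × G => (hG.act p.1.1 p.1.2 p.2).1 ∉ D)
    (fun p q => hG.act p.1.1 p.1.2 q.2 ∈ K) (fun F _ => by
      obtain ⟨x, hx, σ, hσ⟩ := hcon (F.image Prod.fst)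
      exact ⟨(σ, x), hσ, fun p hp => hx p.1 (Finset.mem_image_of_mem _ hp)⟩)
  obtain ⟨σ, c, hs, hcD, hcK⟩ := hM.exists_indiscernible_conjugates hι hA hA₀ hG hK hD
    (fun i => (f i).1) (fun i => (f i).2) hfD hfK
  let ρ : ℤ → G →* G := fun j => hG.act (σ j).1 (σ j).2
  have hE := hM.isHyperdefinable_leftRel hι hA (hG.mono hAA) hK
  have hcov := hM.hasFiniteCovers_of_isBounded hι hA hE hb
  -- since `K` has bounded index, all `c i` with `i < j` are in one coset of the `j`-th conjugate
  have hcoset : ∀ i i' j, i < i' → i' < j → ρ j ((c i')⁻¹ * c i) ∈ K := by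
    intro i i' j hi hi'
    rw [map_mul, map_inv, ← QuotientGroup.leftRel_apply]
    -- the pair `(c i', c i)` is decreasing, and is compared with a descending sequence below `j`
    refine hM.rel_of_seq hι hA hE hcov _ _ (fun n => ρ j (c (j - 1 - n))) fun l m hlm => ?_
    obtain ⟨τ, hτ, h⟩ := hM.exists_equiv_of_indiscernibleOver (K := ULift.{w} (Fin 3))
      (mk_sum_lt hκ.le hι hA) (mk_lt_of_countable hκ) hA₀ hs
      (fun k => ![j - 1 - m, j - 1 - l, j] k.down) (fun k => ![i, i', j] k.down) (by
        rintro ⟨k⟩ ⟨k'⟩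
        fin_cases k <;> fin_cases k' <;> simp <;> omega)
    have hτc : ∀ p q : ℤ, (∀ k, τ ((c p).1 k) = (c q).1 k) → Sum.elim
        (fun k => ((σ j).1.comp (τ.comp (σ j).1.symm)) ((ρ j (c p)).1 k)) (ρ j (c q)).1 ∈
          relSet (QuotientGroup.leftRel K) := by
      intro p q hpq
      convert elim_mem_relSet.2 (Setoid.refl (ρ j (c q))) using 2
      ext k
      change (σ j).1 (τ ((σ j).1.symm ((σ j).1 ((c p).1 k)))) = (σ j).1 ((c q).1 k)
      rw [Language.Equiv.symm_apply_apply, hpq]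
    have hτj : ∀ a : A, τ ((σ j).1.symm a) = (σ j).1.symm a := fun a => h ⟨2⟩ (Sum.inr a)
    refine ⟨(σ j).1.comp (τ.comp (σ j).1.symm), fun a ha => ?_, ?_, ?_⟩
    · simp only [Language.Equiv.comp_apply]
      rw [hτj ⟨a, ha⟩]
      exact (σ j).1.apply_symm_apply a
    · exact hτc _ _ fun k => h ⟨1⟩ (Sum.inl k)
    · exact hτc _ _ fun k => h ⟨0⟩ (Sum.inl k)
  -- `c' m` lies in the conjugate with index `2 * n` if and only if `m ≠ n`
  let c' : ℕ → G := fun n => (c (2 * n + 1))⁻¹ * c (2 * n)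
  have hc' : ∀ m n : ℕ, m ≠ n → ρ (2 * n) (c' m) ∈ K := by
    intro m n hmn
    rcases hmn.lt_or_gt with h | h
    · exact hcoset _ _ _ (by omega) (by omega)
    · rw [map_mul, map_inv]
      exact K.mul_mem (K.inv_mem (hcK _ _ (by omega))) (hcK _ _ (by omega))
  -- finite products of terms `c' m` with odd indices
  let g : ℕ → G := fun N => Nat.rec 1 (fun n x => if Odd n then x * c' n else x) N
  have hg : ∀ N, g (N + 1) = if Odd N then g N * c' N else g N := fun N => rfl
  have hgK : ∀ N n : ℕ, (Even n ∨ N ≤ n) → ρ (2 * n) (g N) ∈ K := by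
    intro N n
    induction N with
    | zero => exact fun _ => (map_one (ρ (2 * n))).symm ▸ K.one_mem
    | succ N ih =>
      intro h
      have ih := ih (h.imp_right fun h => by omega)
      rw [hg]
      split_ifs with hN
      · rw [map_mul]
        refine K.mul_mem ih (hc' _ _ ?_)
        rintro rfl
        rcases h with h | h
        exacts [Nat.not_even_iff_odd.2 hN h, by omega]
      · exact ih
  have hgc : ∀ N n : ℕ, Odd n → n < N → ∃ k ∈ K, ∃ l ∈ K,
      ρ (2 * n) (g N) = k * ρ (2 * n) (c' n) * l := by
    intro N n hn
    induction N with
    | zero => simp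
    | succ N ih =>
      intro h
      rw [hg]
      rcases Nat.lt_succ_iff_lt_or_eq.1 h with h | rfl
      · obtain ⟨k, hk, l, hl, e⟩ := ih h
        split_ifs with hN
        · exact ⟨k, hk, l * ρ (2 * n) (c' N), K.mul_mem hl (hc' _ _ h.ne'), by
            rw [map_mul, e, mul_assoc]⟩
        · exact ⟨k, hk, l, hl, e⟩
      · exact ⟨_, hgK n n (Or.inr le_rfl), 1, K.one_mem, by rw [if_pos hn, map_mul, mul_one]⟩
  -- membership of `g N` in the conjugates of a smaller definable set `D'` detects the parity of `n`
  obtain ⟨D', hD', hKD', hmul⟩ := hM.exists_definable_mul_mul hι hA (hG.mono hAA) hK hD hKD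
  have hgD' : ∀ N n : ℕ, n < N → ((ρ (2 * n) (g N)).1 ∈ D' ↔ Even n) := by
    intro N n hnN
    refine ⟨fun h => ?_, fun h => hKD' (mem_tuples.2 (hgK N n (Or.inl h)))⟩
    by_contra hn
    obtain ⟨k, hk, l, hl, e⟩ := hgc N n (Nat.not_even_iff_odd.1 hn) hnN
    refine hcD (2 * n) ?_
    -- `c (2 * n)` is the product of `c (2 * n + 1)` and `c' n`, and hence of the form `k * g N * l`
    have := hmul (ρ (2 * n) (c (2 * n + 1)) * k⁻¹)
      (K.mul_mem (hcK _ _ (by omega)) (K.inv_mem hk)) l⁻¹ (K.inv_mem hl) _ h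
    rw [e] at this
    convert this using 2
    change ρ (2 * n) _ = _
    simp only [c', map_mul, map_inv]
    group
  obtain ⟨φ, rfl⟩ := Set.definable_iff_exists_formula_sum.1 hD'
  -- saturation yields an element that separates the even indices from the odd ones
  let B : Set M := Set.range fun p : ℤ × A => (σ p.1).1.symm p.2
  let C : ℕ → Set (ι → M) := fun n =>
    {x | φ.Realize (Sum.elim (fun a => (σ (2 * n)).1.symm a) x) ↔ Even n}
  obtain ⟨b, hb⟩ := hM.exists_mem (A := B) hι (mk_range_le.trans_lt (mk_prod_countable_lt hκ hA))
    (Set.range C) (by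
      rintro _ ⟨n, rfl⟩
      have := definable_of_formula (A := B) φ (fun a : A => (σ (2 * n)).1.symm a)
        fun a => ⟨(2 * n, a), rfl⟩
      by_cases hn : Even n
      · convert this using 1
        simp [C, hn]
      · convert this.compl using 1
        ext x
        simp [C, hn]) (by
      intro F hF
      rw [← Set.image_univ] at hF
      obtain ⟨S, -, rfl⟩ := Finset.subset_set_image_iff.1 hF
      refine ⟨(g (S.sup id + 1)).1, fun E hE => ?_⟩
      obtain ⟨n, hn, rfl⟩ := Finset.mem_image.1 hE
      exact (realize_elim_symm _ φ _).trans
        (hgD' _ n (Nat.lt_succ_of_le (Finset.le_sup (f := id) hn))))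
  refine hNIP A ι φ ⟨fun n a => (σ (2 * n)).1.symm a, b, ?_, fun n => hb _ ⟨n, rfl⟩⟩
  exact hs.indiscernible_comp (e := fun n : ℕ => (2 * n : ℤ)) (fun m n h => by
    have : (m : ℤ) < n := by exact_mod_cast h
    show (2 * m : ℤ) < 2 * n
    omega) Sum.inr

/-- Under NIP, a type-definable subgroup of bounded index contains one that needs only the
parameters of the group: the intersection of its conjugates. -/
theorem IsMonster.exists_le_typeDefinableSubgroup (hM : IsMonster M T κ) (hNIP : IsNIP L M)
    (hι : #ι < κ) (hA : #A < κ) (hAA : A₀ ⊆ A) (hG : IsTypeDefinableGroup L G A₀) {K : Subgroup G}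
    (hK : TypeDefinableSubgroup L A K) (hb : IsBounded κ (QuotientGroup.leftRel K)) :
    ∃ N : Subgroup G, N ≤ K ∧ TypeDefinableSubgroup L A₀ N ∧
      IsBounded κ (QuotientGroup.leftRel N) := by
  have hκ := hM.aleph0_lt
  have hK' : TypeDefinable L A (tuples K) := hK
  let Γ := {σ : M ≃[L] M // ∀ a ∈ A₀, σ a = a}
  let 𝒟 := {D : Set (ι → M) // A.Definable L D}
  -- for each definable `D` containing `K`, countably many automorphisms suffice
  have henum : ∀ D : 𝒟, ∃ e : ℕ → Γ, tuples K ⊆ D.1 → ∀ x : G,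
      (∀ n, hG.act (e n).1 (e n).2 x ∈ K) → ∀ σ : Γ, (hG.act σ.1 σ.2 x).1 ∈ D.1 := by
    classical
    intro D
    have h1 : Γ := ⟨Language.Equiv.refl L M, fun _ _ => rfl⟩
    by_cases hKD : tuples K ⊆ D.1
    · obtain ⟨F, hF⟩ := hM.exists_finset_conjugates hNIP hι hA hAA hG hK hb D.2 hKD
      obtain ⟨e, he⟩ := (insert h1 F).countable_toSet.exists_eq_range ⟨h1, by simp⟩
      refine ⟨e, fun _ x hx => hF x fun τ hτ => ?_⟩
      obtain ⟨n, rfl⟩ : τ ∈ Set.range e := he ▸ Finset.mem_coe.2 (Finset.mem_insert_of_mem hτ)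
      exact hx n
    · exact ⟨fun _ => h1, fun h => (hKD h).elim⟩
  choose e he using henum
  let ρ : 𝒟 × ℕ → G →* G := fun p => hG.act (e p.1 p.2).1 (e p.1 p.2).2
  let N : Subgroup G := ⨅ p, K.comap (ρ p)
  -- the small intersection is the intersection of all conjugates
  have hN : ∀ x ∈ N, ∀ σ : Γ, hG.act σ.1 σ.2 x ∈ K := by
    intro x hx σ
    refine mem_tuples.1 (typeDefinable_iff.1 hK' _ fun D hD hKD => ?_)
    exact he ⟨D, hD⟩ hKD x (fun n => Subgroup.mem_iInf.1 hx (⟨D, hD⟩, n)) σ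
  have hS : #(𝒟 × ℕ) < κ := by
    rw [mk_prod, mk_nat, lift_aleph0, lift_uzero]
    exact mul_lt_of_lt hκ.le (hM.mk_definable_lt hι hA) hκ
  refine ⟨N, fun x hx => hN x hx ⟨Language.Equiv.refl L M, fun _ _ => rfl⟩, ?_, ?_⟩
  · let B : Set M := A₀ ∪ Set.range fun p : (𝒟 × ℕ) × A => (e p.1.1 p.1.2).1.symm p.2
    have hB : #B < κ := (mk_union_le _ _).trans_lt (add_lt_of_lt hκ.le
      ((mk_le_mk_of_subset hAA).trans_lt hA) (mk_range_le.trans_lt (mk_prod_lt hκ.le hS hA)))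
    have hAB : A₀ ⊆ B := Set.subset_union_left
    refine hM.typeDefinable_of_invariant hι ((mk_le_mk_of_subset hAA).trans_lt hA) hB hAB
      (TypeDefinableSubgroup.iInf (hG.set.mono hAB) fun p =>
        hK.comap_act hG hAB _ (e p.1 p.2).2 fun a ha => Or.inr ⟨(p, ⟨a, ha⟩), rfl⟩) ?_
    rintro τ hτ _ ⟨x, hx, rfl⟩
    refine ⟨hG.act τ hτ x, Subgroup.mem_iInf.2 fun p => ?_, rfl⟩
    exact hN x hx ⟨(e p.1 p.2).1.comp τ, fun a ha =>
      (congrArg _ (hτ a ha)).trans ((e p.1 p.2).2 a ha)⟩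
  · refine (mk_quotient_iInf_comap_le ρ fun _ => K).trans_lt ?_
    rw [prod_const, lift_id, lift_id]
    exact power_lt_of_isStrongLimit hM.strongLimit hb hS

end NIP

end HyperStable

theorem mainTheorem3 {L : FirstOrder.Language.{u, v}} (T : L.Theory) (hT : T.IsComplete)
    (κ : Cardinal.{w}) (M : Type w) [L.Structure M] (hM : HyperStable.IsMonster M T κ)
    (hdistal : HyperStable.IsDistal L M κ) :
    -- a hyperdefinable set is stable if and only if it is bounded
    (∀ (ι : Type w) (A : Set M) (X : Set (ι → M)) (E : Setoid X), #ι < κ → #A < κ →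
      HyperStable.IsHyperdefinable L A E →
        (HyperStable.IsStable L κ A E ↔ HyperStable.IsBounded κ E)) ∧
    -- for a type-definable group, the components over each small set of parameters agree
    (∀ (ι : Type w) (A₀ : Set M) (G : Set (ι → M)) [Group G], #ι < κ → #A₀ < κ →
      HyperStable.IsTypeDefinableGroup L G A₀ →
        ∀ A : Set M, A₀ ⊆ A → #A < κ →
          ∃ H : Subgroup G, HyperStable.IsGst L κ A H ∧ HyperStable.IsG00 L κ A H) ∧
    -- under NIP they do not depend on the parameters, so that the absolute components exist,
    -- and these agree
    (HyperStable.IsNIP L M →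
      ∀ (ι : Type w) (A₀ : Set M) (G : Set (ι → M)) [Group G], #ι < κ → #A₀ < κ →
        HyperStable.IsTypeDefinableGroup L G A₀ →
          ∃ H : Subgroup G, ∀ A : Set M, A₀ ⊆ A → #A < κ →
            HyperStable.IsGst L κ A H ∧ HyperStable.IsG00 L κ A H) := by
  have h1 : ∀ (ι : Type w) (A : Set M) (X : Set (ι → M)) (E : Setoid X), #ι < κ → #A < κ →
      HyperStable.IsHyperdefinable L A E →
        (HyperStable.IsStable L κ A E ↔ HyperStable.IsBounded κ E) :=
    fun ι A X E hι hA hE => ⟨hM.isBounded_of_isStable hdistal hι hA hE,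
      hM.isStable_of_isBounded hι hA hE⟩
  -- the two components are the least elements of the same set of subgroups
  have h2 : ∀ (ι : Type w) (A : Set M) (G : Set (ι → M)) [Group G], #ι < κ → #A < κ →
      HyperStable.IsTypeDefinableGroup L G A → ∀ H : Subgroup G,
        HyperStable.IsG00 L κ A H → HyperStable.IsGst L κ A H := by
    intro ι A G _ hι hA hG H hH
    have hiff : ∀ K : Subgroup G, HyperStable.TypeDefinableSubgroup L A K →
        (HyperStable.IsStable L κ A (QuotientGroup.leftRel K) ↔
          HyperStable.IsBounded κ (QuotientGroup.leftRel K)) := fun K hK =>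
      h1 ι A G _ hι hA (hM.isHyperdefinable_leftRel hι hA hG hK)
    exact ⟨⟨hH.1.1, (hiff H hH.1.1).2 hH.1.2⟩, fun K hK => hH.2 ⟨hK.1, (hiff K hK.1).1 hK.2⟩⟩
  refine ⟨h1, fun ι A₀ G _ hι _ hG A hAA hA => ?_, fun hNIP ι A₀ G _ hι hA₀ hG => ?_⟩
  · obtain ⟨H, hH⟩ := hM.exists_isG00 hι hA (hG.mono hAA)
    exact ⟨H, h2 ι A G hι hA (hG.mono hAA) H hH, hH⟩
  · obtain ⟨H, hH⟩ := hM.exists_isG00 hι hA₀ hG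
    refine ⟨H, fun A hAA hA => ?_⟩
    have hHA : HyperStable.IsG00 L κ A H := by
      refine ⟨⟨HyperStable.TypeDefinable.mono hH.1.1 hAA, hH.1.2⟩, fun K hK => ?_⟩
      obtain ⟨N, hNK, hN, hNb⟩ := hM.exists_le_typeDefinableSubgroup hNIP hι hA hAA hG hK.1 hK.2
      exact (hH.2 ⟨hN, hNb⟩).trans hNK
    exact ⟨h2 ι A G hι hA (hG.mono hAA) H hHA, hHA⟩
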